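/- Let $N$ be a natural number, let $m_1,\dots,m_N>0$ (masses) and $\ell_1,\dots,\ell_N>0$ (lengths), let $g\in\mathbb R$, put $\alpha_j=\sum_{s=j}^N m_s$ and $\beta_j=\alpha_j\ell_j$, and let $$L(q,p)=\tfrac12\Big(\sum_{i=1}^N\alpha_i\ell_i^2p_i^2+\sum_{1\le i<j\le N}2\alpha_j\ell_i\ell_j\cos(q_i-q_j)\,p_ip_j\Big)+g\sum_{j=1}^N\beta_j\cos q_j ,\qquad q,p\in\mathbb R^N,$$ be the Lagrangian of the coplanar $N$-pendulum. Let $T>0$, let $v\in\mathbb Z^N$ (in particular, $v$ may be any prime rotation vector), and let the forcing term $f\in L^2(\mathbb R/T\mathbb Z,\mathbb R^N)$ satisfy $\int_0^Tf(t)\,dt=0$. Let $E=W^{1,2}(\mathbb R/T\mathbb Z,\mathbb R^N)$ with norm $\|x\|_E^2=\int_0^T(|x|^2+|\dot x|^2)\,dt$, and for $x\in E$ put $$\mathcal L(x)=\int_0^T\big(L(q(t),\dot q(t))+f(t)\cdot q(t)\big)\,dt,\qquad q(t)=x(t)+\frac{2\pi vt}{T},\quad \dot q(t)=\dot x(t)+\frac{2\pi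 v}{T}.$$ Since $\mathcal L$ is invariant under adding to $x$ a constant function with value in $2\pi\mathbb Z^N$, it descends to a functional $\mathcal L$ on $\mathcal E=E/(2\pi\mathbb Z^N)$; by splitting off the mean value, $\mathcal E$ is identified with $T^N\times\widetilde W^{1,2}$, where $T^N=\mathbb R^N/2\pi\mathbb Z^N$ and $\widetilde W^{1,2}$ is the subspace of $E$ of functions with zero mean. Then $\mathcal L$ is well defined (the integrand is integrable on $[0,T]$ for every $x\in E$) and of class $C^1$ on $\mathcal E$, and (i) $\mathcal L$ is bounded from below on $\mathcal E$; (ii) $\mathcal L$ satisfies the Palais–Smale condition on $\mathcal E$: every sequence $(x_k)$ in $\mathcal E$ for which $\mathcal L(x_k)\le C$ for some constant $C$ and all $k$, and for which $\mathcal L'(x_k)\to0$ in the dual space $E^*$ as $k\to\infty$, has a subsequence that converges in $\mathcal E$. -/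

import Mathlib

open MeasureTheory Filter Topology
open scoped ContDiff

noncomputable section

namespace Pendulum

/-! ### The space `E = W^{1,2}(ℝ/Tℤ, ℝ^N)` -/

/-- `L²(ℝ/Tℤ, ℝ^N)`, where `ℝ/Tℤ` carries the measure of total mass `T`, so that
`‖x‖² = ∫₀ᵀ |x(t)|² dt`. -/
abbrev L2 (T : ℝ) [Fact (0 < T)] (N : ℕ) : Type :=
  Lp (EuclideanSpace ℝ (Fin N)) 2 (volume : Measure (AddCircle T))

/-- `y` is the weak derivative of `x` on the circle `ℝ/Tℤ`: integration by parts holds against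
every smooth `T`-periodic test function. -/
def IsWeakDeriv {T : ℝ} [Fact (0 < T)] {N : ℕ} (x y : L2 T N) : Prop :=
  ∀ φ : ℝ → ℝ, ContDiff ℝ ∞ φ → Function.Periodic φ T →
    ∫ t in (0 : ℝ)..T, deriv φ t • x (t : AddCircle T)
      = -∫ t in (0 : ℝ)..T, φ t • y (t : AddCircle T)

section aux

variable {T : ℝ} [Fact (0 < T)] {N : ℕ}

theorem measurePreserving_coe :
    MeasurePreserving (fun t : ℝ => (t : AddCircle T)) (volume.restrict (Set.Ioc 0 T)) volume := by
  have h := AddCircle.measurePreserving_mk T 0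
  rwa [zero_add] at h

theorem ae_coe {P : AddCircle T → Prop} (h : ∀ᵐ s, P s) :
    ∀ᵐ t : ℝ ∂(volume.restrict (Set.Ioc (0 : ℝ) T)), P (t : AddCircle T) :=
  measurePreserving_coe.quasiMeasurePreserving.ae h

theorem intervalIntegrable_coe (x : L2 T N) :
    IntervalIntegrable (fun t : ℝ => x (t : AddCircle T)) volume 0 T := by
  rw [intervalIntegrable_iff_integrableOn_Ioc_of_le (Fact.out : 0 < T).le]
  exact measurePreserving_coe.integrable_comp_of_integrable ((Lp.memLp x).integrable (by norm_num))

theorem intervalIntegral_congr_coe {F : Type*} [NormedAddCommGroup F] [NormedSpace ℝ F]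
    {u w : ℝ → F} (h : ∀ᵐ t ∂(volume.restrict (Set.Ioc (0 : ℝ) T)), u t = w t) :
    ∫ t in (0 : ℝ)..T, u t = ∫ t in (0 : ℝ)..T, w t := by
  rw [intervalIntegral.integral_of_le (Fact.out : 0 < T).le,
    intervalIntegral.integral_of_le (Fact.out : 0 < T).le]
  exact integral_congr_ae h

theorem integral_smul_add {φ : ℝ → ℝ} (hφ : Continuous φ) (x y : L2 T N) :
    ∫ t in (0 : ℝ)..T, φ t • (x + y : L2 T N) (t : AddCircle T)
      = (∫ t in (0 : ℝ)..T, φ t • x (t : AddCircle T))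
        + ∫ t in (0 : ℝ)..T, φ t • y (t : AddCircle T) := by
  rw [← intervalIntegral.integral_add
    ((intervalIntegrable_coe x).continuousOn_smul hφ.continuousOn)
    ((intervalIntegrable_coe y).continuousOn_smul hφ.continuousOn)]
  refine intervalIntegral_congr_coe ?_
  filter_upwards [ae_coe (Lp.coeFn_add x y)] with t ht
  rw [ht, Pi.add_apply, smul_add]

theorem integral_smul_smul (φ : ℝ → ℝ) (c : ℝ) (x : L2 T N) :
    ∫ t in (0 : ℝ)..T, φ t • (c • x : L2 T N) (t : AddCircle T)
      = c • ∫ t in (0 : ℝ)..T, φ t • x (t : AddCircle T) := by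
  rw [← intervalIntegral.integral_smul]
  refine intervalIntegral_congr_coe ?_
  filter_upwards [ae_coe (Lp.coeFn_smul c x)] with t ht
  rw [ht, Pi.smul_apply, smul_comm]

theorem integral_smul_zero (φ : ℝ → ℝ) :
    ∫ t in (0 : ℝ)..T, φ t • (0 : L2 T N) (t : AddCircle T) = 0 := by
  have h := integral_smul_smul φ 0 (0 : L2 T N)
  rwa [zero_smul, zero_smul] at h

theorem isWeakDeriv_const (c : EuclideanSpace ℝ (Fin N)) :
    IsWeakDeriv (Lp.const 2 (volume : Measure (AddCircle T)) c) 0 := by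
  intro φ hφ hper
  have h1 : ∫ t in (0 : ℝ)..T,
      deriv φ t • (Lp.const 2 (volume : Measure (AddCircle T)) c : L2 T N) (t : AddCircle T)
        = ∫ t in (0 : ℝ)..T, deriv φ t • c := by
    refine intervalIntegral_congr_coe ?_
    filter_upwards [ae_coe (Lp.coeFn_const (p := 2) (μ := (volume : Measure (AddCircle T))) c)]
      with t ht
    rw [ht, Function.const_apply]
  rw [h1, integral_smul_zero, neg_zero, intervalIntegral.integral_smul_const,
    intervalIntegral.integral_deriv_eq_sub (fun t _ => (hφ.differentiable (by simp)) t)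
      ((hφ.continuous_deriv (by simp)).intervalIntegrable _ _)]
  have h2 := hper 0
  rw [zero_add] at h2
  rw [h2, sub_self, zero_smul]

end aux

/-- `E = W^{1,2}(ℝ/Tℤ, ℝ^N)`, realised as the space of pairs `(x, ẋ)` in `L² × L²` in which `ẋ` is
the weak derivative of `x`, with the Hilbert norm `‖x‖_E² = ‖x‖² + ‖ẋ‖²`. -/
def sobolev (T : ℝ) [Fact (0 < T)] (N : ℕ) : Submodule ℝ (WithLp 2 (L2 T N × L2 T N)) where
  carrier := {z | IsWeakDeriv z.fst z.snd}
  zero_mem' := fun φ _ _ => by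
    simp only [WithLp.zero_fst, WithLp.zero_snd]
    rw [integral_smul_zero, integral_smul_zero, neg_zero]
  add_mem' := fun {z w} hz hw φ hφ hper => by
    simp only [WithLp.add_fst, WithLp.add_snd]
    rw [integral_smul_add (hφ.continuous_deriv (by simp)), integral_smul_add hφ.continuous,
      hz φ hφ hper, hw φ hφ hper, neg_add]
  smul_mem' := fun c z hz φ hφ hper => by
    simp only [WithLp.smul_fst, WithLp.smul_snd]
    rw [integral_smul_smul, integral_smul_smul, hz φ hφ hper, smul_neg]

abbrev E (T : ℝ) [Fact (0 < T)] (N : ℕ) : Type := sobolev T N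

/-- The function underlying an element of `E`. -/
def E.fn {T : ℝ} [Fact (0 < T)] {N : ℕ} (x : E T N) : L2 T N := x.1.fst

/-- The weak derivative of an element of `E`. -/
def E.dot {T : ℝ} [Fact (0 < T)] {N : ℕ} (x : E T N) : L2 T N := x.1.snd

/-- The constant functions in `E`. -/
def constFn (T : ℝ) [Fact (0 < T)] (N : ℕ) : EuclideanSpace ℝ (Fin N) →+ E T N where
  toFun c := ⟨WithLp.toLp 2 (Lp.const 2 (volume : Measure (AddCircle T)) c, 0),
    isWeakDeriv_const c⟩
  map_zero' := by
    apply Subtype.ext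
    simp
  map_add' c d := by
    apply Subtype.ext
    apply (WithLp.equiv 2 (L2 T N × L2 T N)).injective
    simp [map_add]

/-- The vector `2πk ∈ ℝ^N` for `k ∈ ℤ^N`. -/
def twoPi (N : ℕ) : (Fin N → ℤ) →+ EuclideanSpace ℝ (Fin N) where
  toFun k := WithLp.toLp 2 (fun i => 2 * Real.pi * (k i : ℝ))
  map_zero' := by ext i; simp
  map_add' k l := by ext i; simp [mul_add]

/-- The group `2πℤ^N` of constant functions, as a subgroup of `E`. -/
def periods (T : ℝ) [Fact (0 < T)] (N : ℕ) : AddSubgroup (E T N) :=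
  ((constFn T N).comp (twoPi N)).range

/-- `𝓔 = E / 2πℤ^N`, with the quotient topology. -/
abbrev QuotE (T : ℝ) [Fact (0 < T)] (N : ℕ) : Type := E T N ⧸ periods T N

/-! ### The Lagrangian of the coplanar `N`-pendulum -/

/-- `α_j = ∑_{s ≥ j} m_s`. -/
def alpha {N : ℕ} (m : Fin N → ℝ) (j : Fin N) : ℝ := ∑ s ∈ Finset.Ici j, m s

/-- `β_j = α_j ℓ_j`. -/
def beta {N : ℕ} (m ℓ : Fin N → ℝ) (j : Fin N) : ℝ := alpha m j * ℓ j

/-- The quadratic form `A(q)p·p`. -/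
def kinetic {N : ℕ} (m ℓ : Fin N → ℝ) (q p : EuclideanSpace ℝ (Fin N)) : ℝ :=
  (∑ i, alpha m i * ℓ i ^ 2 * p i ^ 2)
    + ∑ i, ∑ j ∈ Finset.Ioi i, 2 * alpha m j * ℓ i * ℓ j * Real.cos (q i - q j) * p i * p j

/-- `V(q) = g ∑_j β_j cos q_j`. -/
def potential {N : ℕ} (m ℓ : Fin N → ℝ) (g : ℝ) (q : EuclideanSpace ℝ (Fin N)) : ℝ :=
  g * ∑ j, beta m ℓ j * Real.cos (q j)

/-- `L(q, p) = ½ A(q)p·p + V(q)`. -/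
def lagrangian {N : ℕ} (m ℓ : Fin N → ℝ) (g : ℝ) (q p : EuclideanSpace ℝ (Fin N)) : ℝ :=
  1 / 2 * kinetic m ℓ q p + potential m ℓ g q

/-! ### The action functional -/

/-- `q(t) = x(t) + 2πvt/T`. -/
def position {T : ℝ} [Fact (0 < T)] {N : ℕ} (v : Fin N → ℤ) (x : E T N) (t : ℝ) :
    EuclideanSpace ℝ (Fin N) :=
  x.fn (t : AddCircle T) + (t / T) • twoPi N v

/-- `q̇(t) = ẋ(t) + 2πv/T`. -/
def velocity {T : ℝ} [Fact (0 < T)] {N : ℕ} (v : Fin N → ℤ) (x : E T N) (t : ℝ) :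
    EuclideanSpace ℝ (Fin N) :=
  x.dot (t : AddCircle T) + (1 / T) • twoPi N v

/-- The integrand `L(q(t), q̇(t)) + f(t)·q(t)`. -/
def integrand {T : ℝ} [Fact (0 < T)] {N : ℕ} (m ℓ : Fin N → ℝ) (g : ℝ) (v : Fin N → ℤ)
    (f : L2 T N) (x : E T N) (t : ℝ) : ℝ :=
  lagrangian m ℓ g (position v x t) (velocity v x t)
    + inner ℝ (f (t : AddCircle T)) (position v x t)

/-- The action `∫₀ᵀ (L(q, q̇) + f·q) dt` as a functional on `E`. -/
def action {T : ℝ} [Fact (0 < T)] {N : ℕ} (m ℓ : Fin N → ℝ) (g : ℝ) (v : Fin N → ℤ)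
    (f : L2 T N) (x : E T N) : ℝ :=
  ∫ t in (0 : ℝ)..T, integrand m ℓ g v f x t

section aux

variable {T : ℝ} [Fact (0 < T)] {N : ℕ}

theorem lagrangian_add_twoPi (m ℓ : Fin N → ℝ) (g : ℝ) (k : Fin N → ℤ)
    (q p : EuclideanSpace ℝ (Fin N)) :
    lagrangian m ℓ g (q + twoPi N k) p = lagrangian m ℓ g q p := by
  have hk : ∀ i, (q + twoPi N k) i = q i + (k i : ℝ) * (2 * Real.pi) := fun i => by
    simp [twoPi, mul_comm]
  have hc : ∀ i j, Real.cos ((q + twoPi N k) i - (q + twoPi N k) j) = Real.cos (q i - q j) :=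
    fun i j => by
      rw [hk, hk, show q i + (k i : ℝ) * (2 * Real.pi) - (q j + (k j : ℝ) * (2 * Real.pi))
        = (q i - q j) + ((k i - k j : ℤ) : ℝ) * (2 * Real.pi) by push_cast; ring,
        Real.cos_add_int_mul_two_pi]
  simp only [lagrangian, kinetic, potential, hc]
  simp only [hk, Real.cos_add_int_mul_two_pi]

theorem action_add_period (m ℓ : Fin N → ℝ) (g : ℝ) (v : Fin N → ℤ) (f : L2 T N)
    (hf : ∫ t, f t = 0) (x : E T N) (k : Fin N → ℤ) :
    action m ℓ g v f (x + constFn T N (twoPi N k)) = action m ℓ g v f x := by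
  have hT : 0 < T := Fact.out
  have hfi : Integrable (fun t : ℝ => f (t : AddCircle T)) (volume.restrict (Set.Ioc 0 T)) :=
    measurePreserving_coe.integrable_comp_of_integrable
      ((Lp.memLp f).integrable (by norm_num))
  have hf0 : ∫ t : ℝ in Set.Ioc 0 T, f (t : AddCircle T) = 0 := by
    have h := AddCircle.integral_preimage T 0 (fun s => f s)
    rw [zero_add] at h
    rw [h, hf]
  have hint : Integrable (fun t : ℝ => inner ℝ (f (t : AddCircle T)) (twoPi N k))
      (volume.restrict (Set.Ioc 0 T)) := hfi.inner_const _
  have hzero : ∫ t : ℝ in Set.Ioc 0 T, inner ℝ (f (t : AddCircle T)) (twoPi N k) = 0 := by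
    have h := integral_inner (𝕜 := ℝ) hfi (twoPi N k)
    rw [hf0, inner_zero_right] at h
    refine Eq.trans ?_ h
    exact integral_congr_ae (Eventually.of_forall fun t : ℝ => real_inner_comm (twoPi N k) (f (t : AddCircle T)))
  have key : ∀ᵐ t ∂(volume.restrict (Set.Ioc (0 : ℝ) T)),
      integrand m ℓ g v f (x + constFn T N (twoPi N k)) t
        = integrand m ℓ g v f x t + inner ℝ (f (t : AddCircle T)) (twoPi N k) := by
    filter_upwards [ae_coe (Lp.coeFn_add x.fn (constFn T N (twoPi N k)).fn),
      ae_coe (Lp.coeFn_const (p := 2) (μ := (volume : Measure (AddCircle T))) (twoPi N k))]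
      with t h1 h2
    have hp : position v (x + constFn T N (twoPi N k)) t = position v x t + twoPi N k := by
      have h3 : (x + constFn T N (twoPi N k)).fn (t : AddCircle T)
          = x.fn (t : AddCircle T) + twoPi N k := by
        refine Eq.trans h1 ?_
        rw [Pi.add_apply]
        exact congrArg (x.fn (t : AddCircle T) + ·) h2
      rw [position, position, h3]
      abel
    have hv : velocity v (x + constFn T N (twoPi N k)) t = velocity v x t := by
      have h3 : (x + constFn T N (twoPi N k)).dot = x.dot := by
        simp [E.dot, constFn]
      rw [velocity, velocity, h3]
    rw [integrand, integrand, hp, hv, lagrangian_add_twoPi, inner_add_right, add_assoc]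
  rw [action, action, intervalIntegral.integral_of_le hT.le, intervalIntegral.integral_of_le hT.le,
    integral_congr_ae key]
  by_cases hI : Integrable (integrand m ℓ g v f x) (volume.restrict (Set.Ioc 0 T))
  · rw [integral_add hI hint, hzero, add_zero]
  · rw [integral_undef hI, integral_undef]
    intro h
    exact hI ((h.sub hint).congr (Eventually.of_forall fun t => by simp))

end aux

/-- The action functional `𝓛` on `𝓔 = E / 2πℤ^N`; it is well defined because `f` has mean zero. -/
def actionQuot {T : ℝ} [Fact (0 < T)] {N : ℕ} (m ℓ : Fin N → ℝ) (g : ℝ) (v : Fin N → ℤ)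
    (f : L2 T N) (hf : ∫ t, f t = 0) : QuotE T N → ℝ :=
  Quotient.lift (action m ℓ g v f) (by
    intro x y hxy
    obtain ⟨k, hk⟩ := QuotientAddGroup.leftRel_apply.mp hxy
    have hy : y = x + constFn T N (twoPi N k) := by
      rw [AddMonoidHom.comp_apply] at hk
      rw [hk]
      abel
    rw [hy, action_add_period m ℓ g v f hf])

/-! ### The Palais–Smale condition on a quotient of a normed space by a group of translations -/

section PS

variable {X : Type*} [NormedAddCommGroup X] [NormedSpace ℝ X] {H : AddSubgroup X}

/-- `I : X ⧸ H → ℝ` is of class `C¹`: its lift to `X` is. -/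
def IsC1 (I : X ⧸ H → ℝ) : Prop := ContDiff ℝ 1 (fun y : X => I (y : X ⧸ H))

/-- The derivative `I'(ξ)`, a continuous linear functional on the tangent space `X` of `X ⧸ H`
at `ξ`: the Fréchet derivative at `0` of `y ↦ I(ξ + [y])`. -/
def derivAt (I : X ⧸ H → ℝ) (ξ : X ⧸ H) : X →L[ℝ] ℝ :=
  fderiv ℝ (fun y : X => I (ξ + (y : X ⧸ H))) 0

/-- The Palais–Smale condition: every sequence along which `I` is bounded above and `I'` tends to
zero (in the dual norm) has a convergent subsequence. -/
def PalaisSmale (I : X ⧸ H → ℝ) : Prop :=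
  ∀ ξ : ℕ → X ⧸ H, (∃ C : ℝ, ∀ k, I (ξ k) ≤ C) →
    Tendsto (fun k => derivAt I (ξ k)) atTop (𝓝 0) →
    ∃ (η : X ⧸ H) (σ : ℕ → ℕ), StrictMono σ ∧ Tendsto (ξ ∘ σ) atTop (𝓝 η)

end PS

end Pendulum

end

/-! The kinetic form is the kinetic energy of the pendulum: `kinetic m ℓ q p` is the sum over the
masses of `m s` times the squared planar velocity of the `s`-th mass. Successive velocities differ
by `ℓ i * p i` times a unit vector, so the form is bounded below by `c * ‖p‖ ^ 2` with `c > 0`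
independent of `q` (`exists_le_kinetic`). The potential is bounded. Since `f` has mean zero, its
pairing with `x` ignores constants and is at most linear in the norm of `ẋ`. The action therefore
grows quadratically in the velocity (`exists_le_action`), which gives the lower bound and, on
sublevels, a bound on `ẋ`.

For regularity, the action is written as `quadAction`: a quadratic form in the velocity in `L²`,
plus a function of the position, with coefficients depending on the position only through its
continuous representative. These coefficients are `C¹` on the space of continuous functions, because
the cosine there is the real part of the exponential of a Banach algebra (`contDiff_cosPhase`).
Every occurrence of the drift `2πvt/T` under a cosine is periodic because `v` is integral; elsewhere
the drift contributes only an additive constant.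

For Palais–Smale, translation by `2πℤ^N` bounds the value at the origin, the action bounds the
velocities, and Arzelà–Ascoli extracts a uniformly convergent subsequence of positions
(`exists_tendsto_embed`). Testing the derivative at `x k` on `x k - x l` and using coercivity turns
convergence of positions into the Cauchy property of velocities in `L²`
(`cauchySeq_of_tendsto_fderiv_quadAction`). Completeness of `E` finishes the argument. -/

noncomputable section

namespace Pendulum

/-! ### Uniform positivity of the kinetic energy -/

/-- The mass matrix of the pendulum with all the angles put to zero. -/
def massCoeff {N : ℕ} (m ℓ : Fin N → ℝ) (i j : Fin N) : ℝ := alpha m (max i j) * ℓ i * ℓ j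

theorem massCoeff_comm {N : ℕ} (m ℓ : Fin N → ℝ) (i j : Fin N) :
    massCoeff m ℓ i j = massCoeff m ℓ j i := by
  rw [massCoeff, massCoeff, max_comm]; ring

theorem sum_sum_eq_diag_add {N : ℕ} (a : Fin N → Fin N → ℝ) (ha : ∀ i j, a i j = a j i) :
    ∑ i, ∑ j, a i j = (∑ i, a i i) + ∑ i, ∑ j ∈ Finset.Ioi i, 2 * a i j := by
  have h : ∀ i, ∑ j, a i j
      = a i i + ∑ j ∈ Finset.Ioi i, a i j + ∑ j ∈ Finset.Iio i, a i j := by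
    intro i
    have h1 : (Finset.univ : Finset (Fin N)) = insert i (Finset.Ioi i ∪ Finset.Iio i) := by
      ext j
      simp only [Finset.mem_univ, Finset.mem_insert, Finset.mem_union, Finset.mem_Ioi,
        Finset.mem_Iio, true_iff]
      rcases lt_trichotomy i j with h | h | h <;> simp [h]
    rw [h1, Finset.sum_insert (by simp), Finset.sum_union, add_assoc]
    rw [Finset.disjoint_left]
    intro j hj hj'
    exact lt_asymm (Finset.mem_Ioi.mp hj) (Finset.mem_Iio.mp hj')
  have h2 : ∑ i, ∑ j ∈ Finset.Iio i, a i j = ∑ i, ∑ j ∈ Finset.Ioi i, a i j := by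
    rw [Finset.sum_comm' (s' := fun j => Finset.Ioi j) (t' := Finset.univ)
      (by intro x y; simp)]
    exact Finset.sum_congr rfl fun i _ => Finset.sum_congr rfl fun j _ => ha j i
  simp only [h, Finset.sum_add_distrib, h2, ← Finset.mul_sum]
  ring

theorem kinetic_eq_sum {N : ℕ} (m ℓ : Fin N → ℝ) (q p : EuclideanSpace ℝ (Fin N)) :
    kinetic m ℓ q p = ∑ i, ∑ j, massCoeff m ℓ i j * (Real.cos (q i - q j) * p i * p j) := by
  rw [sum_sum_eq_diag_add]
  · rw [kinetic]
    congr 1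
    · refine Finset.sum_congr rfl fun i _ => ?_
      rw [massCoeff, max_self, sub_self, Real.cos_zero]; ring
    · refine Finset.sum_congr rfl fun i _ => Finset.sum_congr rfl fun j hj => ?_
      rw [massCoeff, max_eq_right (Finset.mem_Ioi.mp hj).le]; ring
  · intro i j
    rw [massCoeff_comm, ← Real.cos_neg, neg_sub]; ring

/-- The two inner sums are the components of the velocity of the `s`-th mass. After expanding the
squares, `m s` multiplies the pair `(i, j)` exactly when `max i j ≤ s`; summing over `s` produces
`alpha m (max i j)`. -/
theorem kinetic_eq_sum_sq {N : ℕ} (m ℓ : Fin N → ℝ) (q p : EuclideanSpace ℝ (Fin N)) :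
    kinetic m ℓ q p = ∑ s, m s * ((∑ i ∈ Finset.Iic s, ℓ i * p i * Real.cos (q i)) ^ 2
      + (∑ i ∈ Finset.Iic s, ℓ i * p i * Real.sin (q i)) ^ 2) := by
  have h : ∀ s : Fin N, m s * ((∑ i ∈ Finset.Iic s, ℓ i * p i * Real.cos (q i)) ^ 2
      + (∑ i ∈ Finset.Iic s, ℓ i * p i * Real.sin (q i)) ^ 2)
      = ∑ i, ∑ j, if max i j ≤ s then
          m s * (ℓ i * ℓ j * (Real.cos (q i - q j) * p i * p j)) else 0 := by
    intro s
    have hS : Finset.Iic s = Finset.univ.filter (· ≤ s) := by ext; simp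
    rw [sq, sq, Finset.sum_mul_sum, Finset.sum_mul_sum, ← Finset.sum_add_distrib, Finset.mul_sum,
      hS, Finset.sum_filter]
    refine Finset.sum_congr rfl fun i _ => ?_
    split_ifs with hi
    · rw [← Finset.sum_add_distrib, Finset.mul_sum, Finset.sum_filter]
      refine Finset.sum_congr rfl fun j _ => ?_
      simp only [max_le_iff, hi, true_and]
      split_ifs
      · rw [Real.cos_sub]; ring
      · rfl
    · simp [hi]
  rw [kinetic_eq_sum, Finset.sum_congr rfl fun s _ => h s]
  conv_rhs => rw [Finset.sum_comm]
  refine Finset.sum_congr rfl fun i _ => ?_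
  conv_rhs => rw [Finset.sum_comm]
  refine Finset.sum_congr rfl fun j _ => ?_
  have hS : Finset.Ici (max i j) = Finset.univ.filter (max i j ≤ ·) := by ext; simp
  rw [massCoeff, alpha, ← Finset.sum_filter, ← hS, ← Finset.sum_mul]
  ring

/-- Each term is a difference of two consecutive partial sums, so its square is at most twice the
sum of their squares. The last partial sum is used only once; the surplus `2 * (∑ s, a s) ^ 2`
records this and makes the induction close. -/
theorem sum_sq_add_le_of_partial_sums {N : ℕ} (a : Fin N → ℝ) :
    ∑ s, a s ^ 2 + 2 * (∑ s, a s) ^ 2 ≤ 4 * ∑ s, (∑ i ∈ Finset.Iic s, a i) ^ 2 := by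
  induction N with
  | zero => simp
  | succ n ih =>
    have h := ih fun i => a i.castSucc
    have hl : Finset.Iic (Fin.last n) = Finset.univ := by ext i; simp [Fin.le_last]
    have hc : ∀ s : Fin n, ∑ i ∈ Finset.Iic s.castSucc, a i
        = ∑ i ∈ Finset.Iic s, a i.castSucc := fun s => by
      rw [← Fin.map_castSuccEmb_Iic, Finset.sum_map]; rfl
    rw [Fin.sum_univ_castSucc (fun s => (∑ i ∈ Finset.Iic s, a i) ^ 2), hl]
    simp only [hc]
    rw [Fin.sum_univ_castSucc (fun s => a s ^ 2), Fin.sum_univ_castSucc a]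
    -- With `S` the sum of the first `n` terms and `a` the last one, what remains is `a² - 2S² ≤ 2(S
    -- + a)²`, that is `0 ≤ (2S + a)²`.
    nlinarith [sq_nonneg (2 * (∑ i : Fin n, a i.castSucc) + a (Fin.last n))]

theorem sum_sq_le_of_partial_sums {N : ℕ} (a : Fin N → ℝ) :
    ∑ s, a s ^ 2 ≤ 4 * ∑ s, (∑ i ∈ Finset.Iic s, a i) ^ 2 := by
  nlinarith [sum_sq_add_le_of_partial_sums a, sq_nonneg (∑ s, a s)]

/-- The kinetic energy is positive definite, uniformly in the configuration. -/
theorem exists_le_kinetic {N : ℕ} {m ℓ : Fin N → ℝ} (hm : ∀ i, 0 < m i) (hℓ : ∀ i, 0 < ℓ i) :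
    ∃ c : ℝ, 0 < c ∧ ∀ q p : EuclideanSpace ℝ (Fin N), c * ‖p‖ ^ 2 ≤ kinetic m ℓ q p := by
  obtain ⟨μ, hμ, hμm⟩ : ∃ μ : ℝ, 0 < μ ∧ ∀ i, μ ≤ m i := by
    rcases isEmpty_or_nonempty (Fin N) with h | h
    · exact ⟨1, one_pos, fun i => h.elim i⟩
    · obtain ⟨i, hi⟩ := Finite.exists_min m
      exact ⟨m i, hm i, hi⟩
  obtain ⟨l, hl, hlm⟩ : ∃ l : ℝ, 0 < l ∧ ∀ i, l ≤ ℓ i := by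
    rcases isEmpty_or_nonempty (Fin N) with h | h
    · exact ⟨1, one_pos, fun i => h.elim i⟩
    · obtain ⟨i, hi⟩ := Finite.exists_min ℓ
      exact ⟨ℓ i, hℓ i, hi⟩
  -- `μ` and `l` are lower bounds for the masses and the lengths; the `4` comes from the inequality
  -- for partial sums, applied separately to the cosine and sine components.
  refine ⟨μ * l ^ 2 / 4, by positivity, fun q p => ?_⟩
  have h1 := sum_sq_le_of_partial_sums fun i => ℓ i * p i * Real.cos (q i)
  have h2 := sum_sq_le_of_partial_sums fun i => ℓ i * p i * Real.sin (q i)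
  have h3 : l ^ 2 * ‖p‖ ^ 2
      ≤ ∑ i, (ℓ i * p i * Real.cos (q i)) ^ 2 + ∑ i, (ℓ i * p i * Real.sin (q i)) ^ 2 := by
    rw [EuclideanSpace.real_norm_sq_eq, Finset.mul_sum, ← Finset.sum_add_distrib]
    refine Finset.sum_le_sum fun i _ => ?_
    have : (ℓ i * p i * Real.cos (q i)) ^ 2 + (ℓ i * p i * Real.sin (q i)) ^ 2
        = ℓ i ^ 2 * p i ^ 2 := by
      rw [← mul_one (ℓ i ^ 2 * p i ^ 2), ← Real.cos_sq_add_sin_sq (q i)]; ring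
    rw [this]
    gcongr
    exact hlm i
  have h4 : μ * (∑ s, (∑ i ∈ Finset.Iic s, ℓ i * p i * Real.cos (q i)) ^ 2
      + ∑ s, (∑ i ∈ Finset.Iic s, ℓ i * p i * Real.sin (q i)) ^ 2) ≤ kinetic m ℓ q p := by
    rw [kinetic_eq_sum_sq, ← Finset.sum_add_distrib, Finset.mul_sum]
    refine Finset.sum_le_sum fun i _ => ?_
    gcongr
    exact hμm i
  calc μ * l ^ 2 / 4 * ‖p‖ ^ 2 = μ * ((l ^ 2 * ‖p‖ ^ 2) / 4) := by ring
    _ ≤ μ * (∑ s, (∑ i ∈ Finset.Iic s, ℓ i * p i * Real.cos (q i)) ^ 2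
      + ∑ s, (∑ i ∈ Finset.Iic s, ℓ i * p i * Real.sin (q i)) ^ 2) := by
        gcongr
        linarith
    _ ≤ _ := h4

/-! ### Abstract quadratic functionals and a Cauchy criterion -/

section QuadraticAction

variable {X U P : Type*} [NormedAddCommGroup X] [NormedSpace ℝ X] [NormedAddCommGroup U]
  [NormedSpace ℝ U] [NormedAddCommGroup P] [NormedSpace ℝ P]

/-- A functional that depends quadratically on `D x + p₀`, with coefficients depending on `J x`. -/
def quadAction (J : X →L[ℝ] U) (D : X →L[ℝ] P) (p₀ : P) (K : U → P →L[ℝ] P →L[ℝ] ℝ) (G : U → ℝ)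
    (x : X) : ℝ :=
  1 / 2 * K (J x) (D x + p₀) (D x + p₀) + G (J x)

variable {J : X →L[ℝ] U} {D : X →L[ℝ] P} {p₀ : P} {K : U → P →L[ℝ] P →L[ℝ] ℝ} {G : U → ℝ}

theorem contDiff_quadAction (hK : ContDiff ℝ 1 K) (hG : ContDiff ℝ 1 G) :
    ContDiff ℝ 1 (quadAction J D p₀ K G) := by
  have hD : ContDiff ℝ 1 fun x => D x + p₀ := D.contDiff.add contDiff_const
  exact (contDiff_const.mul (((hK.comp J.contDiff).clm_apply hD).clm_apply hD)).add
    (hG.comp J.contDiff)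

theorem fderiv_quadAction_apply (hK : ContDiff ℝ 1 K) (hG : ContDiff ℝ 1 G)
    (hsymm : ∀ u p p', K u p p' = K u p' p) (x h : X) :
    fderiv ℝ (quadAction J D p₀ K G) x h = K (J x) (D x + p₀) (D h)
      + 1 / 2 * fderiv ℝ K (J x) (J h) (D x + p₀) (D x + p₀) + fderiv ℝ G (J x) (J h) := by
  have hD : HasFDerivAt (fun x => D x + p₀) D x := D.hasFDerivAt.add_const p₀
  have hK' : HasFDerivAt (fun x => K (J x)) ((fderiv ℝ K (J x)).comp J) x :=
    ((hK.differentiable one_ne_zero) (J x)).hasFDerivAt.comp x J.hasFDerivAt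
  have hG' : HasFDerivAt (fun x => G (J x)) ((fderiv ℝ G (J x)).comp J) x :=
    ((hG.differentiable one_ne_zero) (J x)).hasFDerivAt.comp x J.hasFDerivAt
  have h1 := (((hK'.clm_apply hD).clm_apply hD).const_mul (1 / 2 : ℝ)).add hG'
  have h2 : fderiv ℝ (quadAction J D p₀ K G) x = _ := h1.fderiv
  rw [h2]
  simp only [add_apply, smul_apply,
    ContinuousLinearMap.comp_apply, ContinuousLinearMap.flip_apply, smul_eq_mul,
    hsymm (J x) (D h) (D x + p₀)]
  ring

set_option maxSynthPendingDepth 3 in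
/-- A sequence whose positions `J x` converge, whose velocities `D x` are bounded and along which
the derivative of the functional tends to zero, is a Cauchy sequence. -/
theorem cauchySeq_of_tendsto_fderiv_quadAction (hK : ContDiff ℝ 1 K) (hG : ContDiff ℝ 1 G)
    (hsymm : ∀ u p p', K u p p' = K u p' p) {c : ℝ} (hc : 0 < c)
    (hcoer : ∀ u p, c * ‖p‖ ^ 2 ≤ K u p p) {A : ℝ} (hA : ∀ x, ‖x‖ ≤ A * (‖J x‖ + ‖D x‖))
    {x : ℕ → X} {u : U} (hu : Tendsto (fun k => J (x k)) atTop (𝓝 u)) {R : ℝ}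
    (hR : ∀ k, ‖D (x k)‖ ≤ R)
    (hx : Tendsto (fun k => fderiv ℝ (quadAction J D p₀ K G) (x k)) atTop (𝓝 0)) :
    CauchySeq x := by
  have hp : ∀ k, ‖D (x k) + p₀‖ ≤ R + ‖p₀‖ := fun k =>
    (norm_add_le _ _).trans (by gcongr; exact hR k)
  set S := R + ‖p₀‖ with hS
  have hS0 : 0 ≤ S := (norm_nonneg _).trans (hp 0)
  have hKu : Tendsto (fun k => K (J (x k))) atTop (𝓝 (K u)) := (hK.continuous.tendsto u).comp hu
  -- Continuity of the derivatives suffices for bounds along the sequence, because the positions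
  -- converge.
  obtain ⟨M, hM⟩ := ((((hK.continuous_fderiv one_ne_zero).tendsto u).comp hu).norm).bddAbove_range
  obtain ⟨M', hM'⟩ := ((((hG.continuous_fderiv one_ne_zero).tendsto u).comp hu).norm).bddAbove_range
  obtain ⟨B, hB⟩ := hu.norm.bddAbove_range
  replace hM : ∀ k, ‖fderiv ℝ K (J (x k))‖ ≤ M := fun k => hM ⟨k, rfl⟩
  replace hM' : ∀ k, ‖fderiv ℝ G (J (x k))‖ ≤ M' := fun k => hM' ⟨k, rfl⟩
  replace hB : ∀ k, ‖J (x k)‖ ≤ B := fun k => hB ⟨k, rfl⟩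
  have hM0 : 0 ≤ M := (norm_nonneg _).trans (hM 0)
  have hxb : ∀ k, ‖x k‖ ≤ |A| * (B + R) := fun k =>
    (hA _).trans (mul_le_mul (le_abs_self A) (add_le_add (hB k) (hR k)) (by positivity)
      (abs_nonneg A))
  have hvel : ∀ k l, |K (J (x k)) (D (x k) + p₀) (D (x k) - D (x l))|
      ≤ ‖fderiv ℝ (quadAction J D p₀ K G) (x k)‖ * (2 * (|A| * (B + R)))
        + (1 / 2 * (M * S * S) + M') * ‖J (x k) - J (x l)‖ := by
    intro k l
    -- Of the terms of the derivative in the direction `x k - x l`, the leading one pairs the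
    -- velocity with the difference of velocities; all the others carry a factor `J (x k) - J (x
    -- l)`.
    have h := fderiv_quadAction_apply (J := J) (D := D) (p₀ := p₀) hK hG hsymm (x k) (x k - x l)
    rw [map_sub J, map_sub D] at h
    have h1 : |fderiv ℝ (quadAction J D p₀ K G) (x k) (x k - x l)|
        ≤ ‖fderiv ℝ (quadAction J D p₀ K G) (x k)‖ * (2 * (|A| * (B + R))) := by
      refine ((fderiv ℝ (quadAction J D p₀ K G) (x k)).le_opNorm (x k - x l)).trans ?_
      gcongr
      linarith [norm_sub_le (x k) (x l), hxb k, hxb l]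
    have h2 : |fderiv ℝ K (J (x k)) (J (x k) - J (x l)) (D (x k) + p₀) (D (x k) + p₀)|
        ≤ M * S * S * ‖J (x k) - J (x l)‖ := by
      refine ((fderiv ℝ K (J (x k)) (J (x k) - J (x l))).le_opNorm₂ (D (x k) + p₀)
        (D (x k) + p₀)).trans ?_
      calc _ ≤ (M * ‖J (x k) - J (x l)‖) * S * S := by
            have := (fderiv ℝ K (J (x k))).le_of_opNorm_le (hM k) (J (x k) - J (x l))
            have := hp k
            gcongr
        _ = _ := by ring
    have h3 : |fderiv ℝ G (J (x k)) (J (x k) - J (x l))| ≤ M' * ‖J (x k) - J (x l)‖ :=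
      (fderiv ℝ G (J (x k))).le_of_opNorm_le (hM' k) _
    rw [abs_le] at *
    constructor <;> linarith [h1.1, h1.2, h2.1, h2.2, h3.1, h3.2]
  have hΔu : Tendsto (fun n : ℕ × ℕ => ‖J (x n.1) - J (x n.2)‖) atTop (𝓝 0) := by
    simpa only [dist_eq_norm] using cauchySeq_iff_tendsto_dist_atTop_0.mp hu.cauchySeq
  have hΔK : Tendsto (fun n : ℕ × ℕ => ‖K (J (x n.1)) - K (J (x n.2))‖) atTop (𝓝 0) := by
    simpa only [dist_eq_norm] using cauchySeq_iff_tendsto_dist_atTop_0.mp hKu.cauchySeq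
  have hfst : Tendsto (Prod.fst : ℕ × ℕ → ℕ) atTop atTop := by
    rw [← prod_atTop_atTop_eq]; exact tendsto_fst
  have hsnd : Tendsto (Prod.snd : ℕ × ℕ → ℕ) atTop atTop := by
    rw [← prod_atTop_atTop_eq]; exact tendsto_snd
  have hε := hx.norm
  rw [norm_zero] at hε
  have hΔp : Tendsto (fun n : ℕ × ℕ => ‖D (x n.1) - D (x n.2)‖) atTop (𝓝 0) := by
    have hb : ∀ n : ℕ × ℕ, ‖D (x n.1) - D (x n.2)‖ ^ 2 ≤ 1 / c *
        ((‖fderiv ℝ (quadAction J D p₀ K G) (x n.1)‖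
          + ‖fderiv ℝ (quadAction J D p₀ K G) (x n.2)‖) * (2 * (|A| * (B + R)))
        + 2 * (1 / 2 * (M * S * S) + M') * ‖J (x n.1) - J (x n.2)‖
        + ‖K (J (x n.1)) - K (J (x n.2))‖ * S * (2 * R)) := by
      rintro ⟨k, l⟩
      have h1 := hvel k l
      have h2 := hvel l k
      rw [norm_sub_rev (J (x l)), ← neg_sub (D (x k)), map_neg, abs_neg] at h2
      have h3 : |(K (J (x k)) - K (J (x l))) (D (x l) + p₀) (D (x k) - D (x l))|
          ≤ ‖K (J (x k)) - K (J (x l))‖ * S * (2 * R) := by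
        refine ((K (J (x k)) - K (J (x l))).le_opNorm₂ (D (x l) + p₀)
          (D (x k) - D (x l))).trans ?_
        have := hp l
        have : ‖D (x k) - D (x l)‖ ≤ 2 * R := by
          linarith [norm_sub_le (D (x k)) (D (x l)), hR k, hR l]
        gcongr
      have h4 := hcoer (J (x k)) (D (x k) - D (x l))
      -- Coercivity is applied to the difference of velocities. The first two terms on the right are
      -- controlled by `hvel` at `(k, l)` and `(l, k)`, the third by convergence of `K` along the
      -- positions.
      have h5 : K (J (x k)) (D (x k) - D (x l)) (D (x k) - D (x l))
          = K (J (x k)) (D (x k) + p₀) (D (x k) - D (x l))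
            - K (J (x l)) (D (x l) + p₀) (D (x k) - D (x l))
            - (K (J (x k)) - K (J (x l))) (D (x l) + p₀) (D (x k) - D (x l)) := by
        simp only [map_sub, map_add, sub_apply, add_apply]
        ring
      rw [one_div, ← div_eq_inv_mul, le_div_iff₀ hc]
      rw [abs_le] at h1 h2 h3
      dsimp only
      linarith [h1.2, h2.1, h3.1]
    have hlim := ((((hε.comp hfst).add (hε.comp hsnd)).mul_const (2 * (|A| * (B + R)))).add
      (hΔu.const_mul (2 * (1 / 2 * (M * S * S) + M')))).add
      ((hΔK.mul_const S).mul_const (2 * R)) |>.const_mul (1 / c)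
    simp only [zero_mul, mul_zero, add_zero] at hlim
    have hsq := squeeze_zero (fun n => sq_nonneg _) hb hlim
    have := hsq.sqrt
    simpa [Real.sqrt_sq] using this
  rw [cauchySeq_iff_tendsto_dist_atTop_0]
  refine squeeze_zero (g := fun n : ℕ × ℕ => A * (‖J (x n.1) - J (x n.2)‖ + ‖D (x n.1) - D (x n.2)‖))
    (fun n => dist_nonneg) (fun n => ?_) ?_
  · rw [dist_eq_norm, ← map_sub, ← map_sub]
    exact hA _
  · simpa using (hΔu.add hΔp).const_mul A

end QuadraticAction

/-! ### Fourier uniqueness, weak derivatives and primitives on the circle -/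

section Circle

variable {T : ℝ}

theorem periodic_coe {F : Type*} (y : AddCircle T → F) :
    Function.Periodic (fun t : ℝ => y (t : AddCircle T)) T := fun t => by
  simp

/-- The continuous function on the circle given by a continuous periodic function on `ℝ`. -/
def liftPeriodic {F : Type*} [TopologicalSpace F] {φ : ℝ → F} (hφ : Continuous φ)
    (hper : Function.Periodic φ T) : C(AddCircle T, F) where
  toFun := hper.lift
  continuous_toFun := continuous_coinduced_dom.mpr hφ

theorem liftPeriodic_coe {F : Type*} [TopologicalSpace F] {φ : ℝ → F} (hφ : Continuous φ)
    (hper : Function.Periodic φ T) (t : ℝ) : liftPeriodic hφ hper (t : AddCircle T) = φ t :=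
  rfl

theorem periodic_deriv {φ : ℝ → ℝ} (hper : Function.Periodic φ T) :
    Function.Periodic (deriv φ) T := fun t => by
  rw [← deriv_comp_add_const]
  exact congrArg (fun ψ => deriv ψ t) (funext hper)

variable [Fact (0 < T)]

theorem intervalIntegral_coe {F : Type*} [NormedAddCommGroup F] [NormedSpace ℝ F]
    (y : AddCircle T → F) : ∫ t in (0 : ℝ)..T, y (t : AddCircle T) = ∫ s, y s := by
  simpa using AddCircle.intervalIntegral_preimage T 0 y

theorem intervalIntegrable_coe_of_integrable {F : Type*} [NormedAddCommGroup F]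
    {y : AddCircle T → F} (hy : Integrable y) (a b : ℝ) :
    IntervalIntegrable (fun t : ℝ => y (t : AddCircle T)) volume a b := by
  refine (periodic_coe y).intervalIntegrable₀ (Fact.out : 0 < T).ne' ?_ a b
  rw [intervalIntegrable_iff_integrableOn_Ioc_of_le (Fact.out : 0 < T).le]
  exact measurePreserving_coe.integrable_comp_of_integrable hy

/-- Completeness of the Fourier basis: the real integrals assemble into the complex Fourier
coefficients, which all vanish. -/
theorem ae_eq_zero_of_integral_cos_sin {g : AddCircle T → ℝ} (hg : MemLp g 2 volume)
    (hc : ∀ n : ℤ, ∫ t in (0 : ℝ)..T, Real.cos (2 * Real.pi * n / T * t) * g t = 0)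
    (hs : ∀ n : ℤ, ∫ t in (0 : ℝ)..T, Real.sin (2 * Real.pi * n / T * t) * g t = 0) :
    g =ᵐ[volume] 0 := by
  have hT : 0 < T := Fact.out
  have hG : MemLp (fun s => (g s : ℂ)) 2 (AddCircle.haarAddCircle (T := T)) :=
    MemLp.haarAddCircle hg.ofReal
  have hgi : IntervalIntegrable (fun t : ℝ => g (t : AddCircle T)) volume 0 T :=
    intervalIntegrable_coe_of_integrable (hg.integrable (by norm_num)) _ _
  have hcoef : ∀ n : ℤ, fourierCoeff (fun s => (g s : ℂ)) n = 0 := by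
    intro n
    rw [fourierCoeff_eq_intervalIntegral _ n 0, zero_add]
    have h : ∀ t : ℝ, (fourier (-n) (t : AddCircle T) : ℂ) • (g (t : AddCircle T) : ℂ)
        = ((Real.cos (2 * Real.pi * (-n : ℤ) / T * t) * g t : ℝ) : ℂ)
          + Complex.I * ((Real.sin (2 * Real.pi * (-n : ℤ) / T * t) * g t : ℝ) : ℂ) := by
      intro t
      rw [fourier_coe_apply, show 2 * (Real.pi : ℂ) * Complex.I * ((-n : ℤ) : ℂ) * t / T
        = ((2 * Real.pi * (-n : ℤ) / T * t : ℝ) : ℂ) * Complex.I by push_cast; ring,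
        Complex.exp_mul_I]
      rw [← Complex.ofReal_cos, ← Complex.ofReal_sin, smul_eq_mul]
      push_cast
      ring
    rw [intervalIntegral.integral_congr fun t _ => h t, intervalIntegral.integral_add,
      intervalIntegral.integral_const_mul, intervalIntegral.integral_ofReal,
      intervalIntegral.integral_ofReal, hc, hs]
    · simp
    · have := hgi.continuousOn_mul (g := fun t => Real.cos (2 * Real.pi * (-n : ℤ) / T * t))
        (by fun_prop)
      exact ⟨this.1.ofReal, this.2.ofReal⟩
    · have := hgi.continuousOn_mul (g := fun t => Real.sin (2 * Real.pi * (-n : ℤ) / T * t))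
        (by fun_prop)
      exact IntervalIntegrable.const_mul ⟨this.1.ofReal, this.2.ofReal⟩ _
  have h0 : hG.toLp _ = 0 := by
    apply fourierBasis.repr.injective
    rw [map_zero]
    ext n
    rw [fourierBasis_repr, fourierCoeff_congr_ae hG.coeFn_toLp, hcoef]
    rfl
  have h1 : (fun s => (g s : ℂ)) =ᵐ[AddCircle.haarAddCircle] 0 := by
    rw [← hG.toLp_eq_toLp_iff MemLp.zero, h0]
    rfl
  -- Fourier theory uses the Haar measure of total mass one; `volume` is a multiple of it and has no
  -- further null-set conditions.
  have h2 : (fun s => (g s : ℂ)) =ᵐ[volume] 0 := by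
    rw [AddCircle.volume_eq_smul_haarAddCircle]
    exact Measure.ae_smul_measure h1 _
  filter_upwards [h2] with s hs
  simpa using hs

/-- A function on the circle with vanishing weak derivative is constant. -/
theorem ae_eq_const_of_integral_deriv_mul {f : AddCircle T → ℝ} (hf : MemLp f 2 volume)
    (h : ∀ φ : ℝ → ℝ, ContDiff ℝ ∞ φ → Function.Periodic φ T →
      ∫ t in (0 : ℝ)..T, deriv φ t * f t = 0) :
    ∃ c : ℝ, f =ᵐ[volume] fun _ => c := by
  have hT : 0 < T := Fact.out
  have hfi : IntervalIntegrable (fun t : ℝ => f (t : AddCircle T)) volume 0 T :=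
    intervalIntegrable_coe_of_integrable (hf.integrable (by norm_num)) _ _
  set c : ℝ := T⁻¹ * ∫ t in (0 : ℝ)..T, f t with hcdef
  have hg : MemLp (fun s => f s - c) 2 volume := hf.sub (memLp_const c)
  have hgφ : ∀ φ : ℝ → ℝ, ContDiff ℝ ∞ φ → Function.Periodic φ T →
      ∫ t in (0 : ℝ)..T, deriv φ t * (f t - c) = 0 := by
    intro φ hφ hper
    have hd : Continuous (deriv φ) := hφ.continuous_deriv (by simp)
    have hdc : IntervalIntegrable (fun t => deriv φ t * c) volume 0 T :=
      (hd.mul continuous_const).intervalIntegrable _ _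
    simp only [mul_sub]
    rw [intervalIntegral.integral_sub (hfi.continuousOn_mul hd.continuousOn)
      hdc, h φ hφ hper,
      intervalIntegral.integral_mul_const, intervalIntegral.integral_deriv_eq_sub
      (fun t _ => (hφ.differentiable (by simp)) t) (hd.intervalIntegrable _ _)]
    have := hper 0
    rw [zero_add] at this
    simp [this]
  have hper : ∀ (n : ℤ) (t : ℝ), 2 * Real.pi * n / T * (t + T)
      = 2 * Real.pi * n / T * t + n * (2 * Real.pi) := fun n t => by field_simp
  -- The frequency `n = 0` is handled by subtracting the mean `c`. For `n ≠ 0`, the cosine and sine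
  -- of frequency `n` are themselves derivatives of smooth periodic functions, so they are
  -- admissible.
  have hzero : (fun s => f s - c) =ᵐ[volume] 0 := by
    refine ae_eq_zero_of_integral_cos_sin hg (fun n => ?_) (fun n => ?_)
    · by_cases hn : n = 0
      · subst hn
        simp only [Int.cast_zero, mul_zero, zero_div, zero_mul, Real.cos_zero, one_mul]
        rw [intervalIntegral.integral_sub hfi (by simp), hcdef]
        simp only [intervalIntegral.integral_const, sub_zero, smul_eq_mul]
        field_simp
        simp
      · have hθ : 2 * Real.pi * n / T ≠ 0 := by
          have : (n : ℝ) ≠ 0 := by exact_mod_cast hn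
          positivity
        have hd : deriv (fun t => (2 * Real.pi * n / T)⁻¹ * Real.sin (2 * Real.pi * n / T * t))
            = fun t => Real.cos (2 * Real.pi * n / T * t) := by
          funext t
          have h1 := (((hasDerivAt_id t).const_mul (2 * Real.pi * n / T)).sin).const_mul
            (2 * Real.pi * n / T)⁻¹
          refine HasDerivAt.deriv (h1.congr_deriv ?_)
          simp only [id, mul_one]
          rw [mul_comm (Real.cos _), inv_mul_cancel_left₀ hθ]
        have h0 := hgφ (fun t => (2 * Real.pi * n / T)⁻¹ * Real.sin (2 * Real.pi * n / T * t))
          (by fun_prop) (fun t => by simp only [hper, Real.sin_add_int_mul_two_pi])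
        rwa [hd] at h0
    · by_cases hn : n = 0
      · subst hn
        simp
      · have hθ : 2 * Real.pi * n / T ≠ 0 := by
          have : (n : ℝ) ≠ 0 := by exact_mod_cast hn
          positivity
        have hd : deriv (fun t => -(2 * Real.pi * n / T)⁻¹ * Real.cos (2 * Real.pi * n / T * t))
            = fun t => Real.sin (2 * Real.pi * n / T * t) := by
          funext t
          have h1 := (((hasDerivAt_id t).const_mul (2 * Real.pi * n / T)).cos).const_mul
            (-(2 * Real.pi * n / T)⁻¹)
          refine HasDerivAt.deriv (h1.congr_deriv ?_)
          simp only [id, mul_one, neg_mul, mul_neg, neg_neg]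
          rw [mul_comm (Real.sin _), inv_mul_cancel_left₀ hθ]
        have h0 := hgφ (fun t => -(2 * Real.pi * n / T)⁻¹ * Real.cos (2 * Real.pi * n / T * t))
          (by fun_prop) (fun t => by simp only [hper, Real.cos_add_int_mul_two_pi])
        rwa [hd] at h0
  refine ⟨c, ?_⟩
  filter_upwards [hzero] with s hs
  simpa [sub_eq_zero] using hs

/-- Integration by parts on a period against a primitive. -/
theorem integral_deriv_mul_primitive {y : ℝ → ℝ} (hy : IntervalIntegrable y volume 0 T)
    (hy0 : ∫ t in (0 : ℝ)..T, y t = 0) {φ : ℝ → ℝ} (hφ : ContDiff ℝ ∞ φ) :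
    ∫ t in (0 : ℝ)..T, deriv φ t * (∫ s in (0 : ℝ)..t, y s)
      = -∫ t in (0 : ℝ)..T, φ t * y t := by
  have hT : 0 < T := Fact.out
  have hac := hy.absolutelyContinuousOnInterval_intervalIntegral (c := 0) (by simp)
  have hφac : AbsolutelyContinuousOnInterval φ 0 T :=
    (hφ.of_le (by exact_mod_cast le_top)).contDiffOn.absolutelyContinuousOnInterval
  have h := hφac.integral_mul_deriv_eq_deriv_mul hac
  -- Both boundary terms vanish: the primitive is zero at `0` by normalisation and at `T` by `hy0`.
  simp only [hy0, intervalIntegral.integral_same, mul_zero, sub_zero, zero_sub] at h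
  rw [← neg_eq_iff_eq_neg, ← h]
  refine intervalIntegral.integral_congr_ae ?_
  filter_upwards [hy.ae_hasDerivAt_integral] with t ht hmem
  rw [(ht (Set.uIoc_subset_uIcc hmem) 0 (by simp)).deriv]

end Circle

/-! ### Continuous representatives, completeness and compactness in `E` -/

section Sobolev

variable {T : ℝ} [Fact (0 < T)] {N : ℕ}

theorem integral_dot (x : E T N) : ∫ t in (0 : ℝ)..T, x.dot (t : AddCircle T) = 0 := by
  -- Testing against the constant function `1` shows that a weak derivative has mean zero.
  have h := x.2 (fun _ => 1) contDiff_const (fun _ => rfl)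
  simp only [deriv_const', zero_smul, intervalIntegral.integral_zero, one_smul] at h
  exact neg_eq_zero.mp h.symm

theorem integral_apply {y : ℝ → EuclideanSpace ℝ (Fin N)} {a b : ℝ}
    (hy : IntervalIntegrable y volume a b) (i : Fin N) :
    (∫ t in a..b, y t) i = ∫ t in a..b, y t i :=
  ((EuclideanSpace.proj i : EuclideanSpace ℝ (Fin N) →L[ℝ] ℝ).intervalIntegral_comp_comm hy).symm

theorem integrable_L2 (y : L2 T N) : Integrable y :=
  (Lp.memLp y).integrable (by norm_num)

/-- Elements of `E` are absolutely continuous. -/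
theorem exists_continuous_rep (x : E T N) :
    ∃ u : C(AddCircle T, EuclideanSpace ℝ (Fin N)), x.fn =ᵐ[volume] u ∧
      ∀ a b : ℝ, u b - u a = ∫ t in a..b, x.dot (t : AddCircle T) := by
  have hint : ∀ a b, IntervalIntegrable (fun t : ℝ => x.dot (t : AddCircle T)) volume a b :=
    intervalIntegrable_coe_of_integrable (integrable_L2 x.dot)
  have hcont : Continuous fun t : ℝ => ∫ s in (0 : ℝ)..t, x.dot (s : AddCircle T) :=
    intervalIntegral.continuous_primitive hint 0
  have hper : Function.Periodic (fun t : ℝ => ∫ s in (0 : ℝ)..t, x.dot (s : AddCircle T)) T := by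
    intro t
    dsimp only
    rw [← intervalIntegral.integral_add_adjacent_intervals (hint 0 t) (hint t (t + T)),
      (periodic_coe x.dot).intervalIntegral_add_eq t 0, zero_add, integral_dot, add_zero]
  -- The primitive of `x.dot` is periodic because `x.dot` has mean zero. It has the same weak
  -- derivative as `x.fn`, so coordinatewise the two differ by a constant.
  have hc : ∀ i, ∃ c : ℝ,
      (fun s => x.fn s i - liftPeriodic hcont hper s i) =ᵐ[volume] fun _ => c := by
    intro i
    have hw : MemLp (fun s => x.fn s - liftPeriodic hcont hper s) 2 volume :=
      (Lp.memLp x.fn).sub ((liftPeriodic hcont hper).continuous.memLp_of_hasCompactSupport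
        (HasCompactSupport.of_compactSpace _))
    refine ae_eq_const_of_integral_deriv_mul
      ((EuclideanSpace.proj i : EuclideanSpace ℝ (Fin N) →L[ℝ] ℝ).comp_memLp' hw) ?_
    intro φ hφ hφper
    have hd : Continuous (deriv φ) := hφ.continuous_deriv (by simp)
    have h1 := congrArg (fun z : EuclideanSpace ℝ (Fin N) => z i) (x.2 φ hφ hφper)
    simp only [PiLp.neg_apply] at h1
    rw [integral_apply ((intervalIntegrable_coe _).continuousOn_smul hd.continuousOn),
      integral_apply ((intervalIntegrable_coe _).continuousOn_smul hφ.continuous.continuousOn)] at h1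
    have hinti : IntervalIntegrable (fun t : ℝ => x.dot (t : AddCircle T) i) volume 0 T :=
      ⟨(EuclideanSpace.proj i : EuclideanSpace ℝ (Fin N) →L[ℝ] ℝ).integrable_comp (hint 0 T).1,
        (EuclideanSpace.proj i : EuclideanSpace ℝ (Fin N) →L[ℝ] ℝ).integrable_comp (hint 0 T).2⟩
    have hintf : IntervalIntegrable (fun t : ℝ => x.fn (t : AddCircle T) i) volume 0 T :=
      ⟨(EuclideanSpace.proj i : EuclideanSpace ℝ (Fin N) →L[ℝ] ℝ).integrable_comp
        (intervalIntegrable_coe x.fn).1,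
        (EuclideanSpace.proj i : EuclideanSpace ℝ (Fin N) →L[ℝ] ℝ).integrable_comp
        (intervalIntegrable_coe x.fn).2⟩
    have hinti0 : ∫ t in (0 : ℝ)..T, x.dot (t : AddCircle T) i = 0 := by
      rw [← integral_apply (hint 0 T), integral_dot]; rfl
    have h2 := integral_deriv_mul_primitive hinti hinti0 hφ
    have h3 : ∀ t : ℝ, liftPeriodic hcont hper (t : AddCircle T) i
        = ∫ s in (0 : ℝ)..t, x.dot (s : AddCircle T) i := fun t => by
      rw [liftPeriodic_coe, integral_apply (hint 0 t)]
    have hcontY : Continuous fun t : ℝ => ∫ s in (0 : ℝ)..t, x.dot (s : AddCircle T) i := by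
      simp only [← h3]
      fun_prop
    have h4 : IntervalIntegrable (fun t : ℝ => deriv φ t * ∫ s in (0 : ℝ)..t,
        x.dot (s : AddCircle T) i) volume 0 T := (hd.mul hcontY).intervalIntegrable _ _
    have h5 : ∀ t : ℝ, deriv φ t * (x.fn (t : AddCircle T) i - liftPeriodic hcont hper t i)
        = deriv φ t * x.fn (t : AddCircle T) i
          - deriv φ t * ∫ s in (0 : ℝ)..t, x.dot (s : AddCircle T) i := fun t => by
      rw [h3, mul_sub]
    refine (intervalIntegral.integral_congr fun t _ => h5 t).trans ?_
    rw [intervalIntegral.integral_sub (hintf.continuousOn_mul hd.continuousOn) h4, h2, sub_neg_eq_add]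
    exact add_eq_zero_iff_eq_neg.mpr h1
  choose c hc using hc
  refine ⟨liftPeriodic hcont hper + ContinuousMap.const _ (WithLp.toLp 2 c), ?_, ?_⟩
  · filter_upwards [ae_all_iff.mpr hc] with s hs
    ext i
    have := hs i
    simp only [ContinuousMap.add_apply, ContinuousMap.const_apply, PiLp.add_apply]
    linarith
  · intro a b
    simp only [ContinuousMap.add_apply, ContinuousMap.const_apply, liftPeriodic_coe,
      add_sub_add_right_eq_sub]
    exact intervalIntegral.integral_interval_sub_left (hint 0 b) (hint 0 a)

theorem norm_sq_eq_integral (y : L2 T N) : ‖y‖ ^ 2 = ∫ s, ‖y s‖ ^ 2 := by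
  rw [← real_inner_self_eq_norm_sq, L2.inner_def]
  simp only [real_inner_self_eq_norm_sq]

/-- Cauchy–Schwarz. The condition `b ≤ a + T` ensures that the interval covers the circle at most
once, so the integral of `‖y‖ ^ 2` over it is at most the full norm squared. -/
theorem norm_integral_sq_le (y : L2 T N) {a b : ℝ} (hab : a ≤ b) (hbT : b ≤ a + T) :
    ‖∫ t in a..b, y (t : AddCircle T)‖ ^ 2 ≤ (b - a) * ‖y‖ ^ 2 := by
  have h1 : ∀ a b : ℝ, IntervalIntegrable (fun t : ℝ => ‖y (t : AddCircle T)‖) volume a b :=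
    intervalIntegrable_coe_of_integrable (integrable_L2 y).norm
  have h2 : ∀ a b : ℝ, IntervalIntegrable (fun t : ℝ => ‖y (t : AddCircle T)‖ ^ 2) volume a b :=
    intervalIntegrable_coe_of_integrable ((Lp.memLp y).integrable_norm_pow (by norm_num))
  have h3 : ∫ t in a..b, ‖y (t : AddCircle T)‖ ^ 2 ≤ ‖y‖ ^ 2 := by
    rw [norm_sq_eq_integral, ← AddCircle.intervalIntegral_preimage T a]
    exact intervalIntegral.integral_mono_interval le_rfl hab hbT
      (Eventually.of_forall fun t => sq_nonneg _) (h2 _ _)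
  set I := ∫ t in a..b, ‖y (t : AddCircle T)‖ with hI
  -- Cauchy–Schwarz is obtained from the discriminant of this quadratic in `μ`, which dominates the
  -- integral of `(1 - μ * ‖y‖) ^ 2`.
  have h4 : ∀ μ : ℝ, 0 ≤ ‖y‖ ^ 2 * (μ * μ) + (-2 * I) * μ + (b - a) := by
    intro μ
    have h : 0 ≤ ∫ t in a..b, (1 - μ * ‖y (t : AddCircle T)‖) ^ 2 :=
      intervalIntegral.integral_nonneg hab fun t _ => sq_nonneg _
    have h' : ∫ t in a..b, (1 - μ * ‖y (t : AddCircle T)‖) ^ 2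
        = (b - a) - 2 * μ * I + μ ^ 2 * ∫ t in a..b, ‖y (t : AddCircle T)‖ ^ 2 := by
      rw [hI, ← intervalIntegral.integral_const_mul, ← intervalIntegral.integral_const_mul,
        show b - a = ∫ t in a..b, (1 : ℝ) by simp, ← intervalIntegral.integral_sub (by simp)
        ((h1 a b).const_mul _), ← intervalIntegral.integral_add
        (IntervalIntegrable.sub (by simp) ((h1 a b).const_mul _)) ((h2 a b).const_mul _)]
      exact intervalIntegral.integral_congr fun t _ => by ring
    nlinarith [mul_le_mul_of_nonneg_left h3 (sq_nonneg μ)]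
  have h5 := discrim_le_zero h4
  rw [discrim] at h5
  have h6 : ‖∫ t in a..b, y (t : AddCircle T)‖ ≤ I :=
    intervalIntegral.norm_integral_le_integral_norm hab
  nlinarith [norm_nonneg (∫ t in a..b, y (t : AddCircle T))]

theorem integral_smul_eq_lpPairing {φ : ℝ → ℝ} (hφ : Continuous φ) (hper : Function.Periodic φ T)
    (x : L2 T N) : ∫ t in (0 : ℝ)..T, φ t • x (t : AddCircle T)
      = (ContinuousLinearMap.lsmul ℝ ℝ).lpPairing volume 2 2
        (ContinuousMap.toLp 2 volume ℝ (liftPeriodic hφ hper)) x := by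
  rw [ContinuousLinearMap.lpPairing_eq_integral, ← intervalIntegral_coe]
  refine intervalIntegral_congr_coe ?_
  filter_upwards [ae_coe (ContinuousMap.coeFn_toLp volume (p := 2) (𝕜 := ℝ)
    (liftPeriodic hφ hper))] with t ht
  rw [ht]
  rfl

theorem continuous_integral_smul {φ : ℝ → ℝ} (hφ : Continuous φ) (hper : Function.Periodic φ T) :
    Continuous fun x : L2 T N => ∫ t in (0 : ℝ)..T, φ t • x (t : AddCircle T) := by
  simp only [integral_smul_eq_lpPairing hφ hper]
  exact ContinuousLinearMap.continuous _

/-- Each test function imposes an equality between two functionals continuous on `L² × L²`.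
Closedness makes `E` complete, as needed for the closed graph theorem and for the final limit. -/
theorem isClosed_sobolev : IsClosed (sobolev T N : Set (WithLp 2 (L2 T N × L2 T N))) := by
  have h : (sobolev T N : Set (WithLp 2 (L2 T N × L2 T N)))
      = ⋂ (φ : ℝ → ℝ) (_ : ContDiff ℝ ∞ φ) (_ : Function.Periodic φ T),
        {z | ∫ t in (0 : ℝ)..T, deriv φ t • z.fst (t : AddCircle T)
          = -∫ t in (0 : ℝ)..T, φ t • z.snd (t : AddCircle T)} := by
    ext z
    simp only [Set.mem_iInter, Set.mem_ofPred_eq]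
    rfl
  rw [h]
  refine isClosed_iInter fun φ => isClosed_iInter fun hφ => isClosed_iInter fun hper => ?_
  exact isClosed_eq
    ((continuous_integral_smul (hφ.continuous_deriv (by simp)) (periodic_deriv hper)).comp
      (WithLp.fstL 2 ℝ (L2 T N) (L2 T N)).continuous)
    ((continuous_integral_smul hφ.continuous hper).comp
      (WithLp.sndL 2 ℝ (L2 T N) (L2 T N)).continuous).neg

instance : CompleteSpace (E T N) := isClosed_sobolev.completeSpace_coe

/-- `E.fn` as a continuous linear map. -/
def fnL : E T N →L[ℝ] L2 T N := (WithLp.fstL 2 ℝ (L2 T N) (L2 T N)).comp (sobolev T N).subtypeL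

/-- `E.dot` as a continuous linear map. -/
def dotL : E T N →L[ℝ] L2 T N := (WithLp.sndL 2 ℝ (L2 T N) (L2 T N)).comp (sobolev T N).subtypeL

theorem dotL_apply (x : E T N) : dotL x = x.dot := rfl

/-- The continuous representative of an element of `E`. -/
def rep (x : E T N) : C(AddCircle T, EuclideanSpace ℝ (Fin N)) := (exists_continuous_rep x).choose

theorem coeFn_fn (x : E T N) : x.fn =ᵐ[volume] rep x := (exists_continuous_rep x).choose_spec.1

theorem rep_sub_rep (x : E T N) (a b : ℝ) :
    rep x b - rep x a = ∫ t in a..b, x.dot (t : AddCircle T) :=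
  (exists_continuous_rep x).choose_spec.2 a b

theorem toLp_rep (x : E T N) : ContinuousMap.toLp 2 volume ℝ (rep x) = x.fn :=
  Lp.ext ((ContinuousMap.coeFn_toLp volume (rep x)).trans (coeFn_fn x).symm)

theorem eq_rep_of_toLp_eq {x : E T N} {u : C(AddCircle T, EuclideanSpace ℝ (Fin N))}
    (h : ContinuousMap.toLp 2 volume ℝ u = x.fn) : u = rep x :=
  ContinuousMap.toLp_injective (p := 2) (𝕜 := ℝ) volume (h.trans (toLp_rep x).symm)

/-- The embedding of `E` into the space of continuous functions. -/
def embed : E T N →L[ℝ] C(AddCircle T, EuclideanSpace ℝ (Fin N)) :=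
  -- Linearity follows from uniqueness of the continuous representative. Continuity follows from the
  -- closed graph theorem: a uniform limit of representatives is also their `L²` limit.
  ContinuousLinearMap.ofSeqClosedGraph (g :=
    { toFun := rep
      map_add' := fun x y => (eq_rep_of_toLp_eq (by
        rw [map_add, toLp_rep, toLp_rep]; exact (map_add fnL x y).symm)).symm
      map_smul' := fun c x => (eq_rep_of_toLp_eq (by
        rw [map_smul, toLp_rep]; exact (map_smul fnL c x).symm)).symm }) (by
    intro x y u hx hu
    refine eq_rep_of_toLp_eq ?_
    refine tendsto_nhds_unique (((ContinuousMap.toLp 2 volume ℝ).continuous.tendsto u).comp hu)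
      (Tendsto.congr (fun k => ?_) ((fnL.continuous.tendsto y).comp hx))
    exact (toLp_rep (x k)).symm)

theorem embed_apply (x : E T N) : embed x = rep x := rfl

/-- Hölder continuity of exponent one half, with a constant depending only on the velocity: the
source of equicontinuity. -/
theorem norm_embed_sub_sq_le (x : E T N) {a b : ℝ} (h : |b - a| ≤ T) :
    ‖embed x b - embed x a‖ ^ 2 ≤ |b - a| * ‖x.dot‖ ^ 2 := by
  rw [abs_le] at h
  rcases le_total a b with hab | hab
  · rw [embed_apply, rep_sub_rep, abs_of_nonneg (by linarith)]
    exact norm_integral_sq_le _ hab (by linarith)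
  · rw [embed_apply, norm_sub_rev, rep_sub_rep, abs_of_nonpos (by linarith), neg_sub]
    exact norm_integral_sq_le _ hab (by linarith)

theorem norm_embed_sub_le (x : E T N) (s : AddCircle T) :
    ‖embed x s - embed x (0 : ℝ)‖ ≤ √T * ‖x.dot‖ := by
  have hT : 0 < T := Fact.out
  obtain ⟨t, ht, rfl⟩ : s ∈ ((↑) : ℝ → AddCircle T) '' Set.Ico 0 (0 + T) := by
    rw [AddCircle.coe_image_Ico_eq]
    trivial
  rw [zero_add] at ht
  rw [← Real.sqrt_sq (norm_nonneg x.dot), ← Real.sqrt_mul hT.le]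
  refine Real.le_sqrt_of_sq_le ((norm_embed_sub_sq_le x ?_).trans ?_)
  · rw [sub_zero, abs_of_nonneg ht.1]; exact ht.2.le
  · gcongr
    rw [sub_zero, abs_of_nonneg ht.1]; exact ht.2.le

theorem norm_le_embed_add_dot :
    ∃ A : ℝ, ∀ x : E T N, ‖x‖ ≤ A * (‖embed x‖ + ‖dotL x‖) := by
  set B := ‖(ContinuousMap.toLp 2 volume ℝ :
    C(AddCircle T, EuclideanSpace ℝ (Fin N)) →L[ℝ] L2 T N)‖
  refine ⟨B + 1, fun x => ?_⟩
  have h1 : ‖x‖ ≤ ‖x.fn‖ + ‖x.dot‖ := by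
    have h2 : ‖x‖ = √(‖x.fn‖ ^ 2 + ‖x.dot‖ ^ 2) := WithLp.prod_norm_eq_of_L2 x.1
    rw [h2]
    refine Real.sqrt_le_iff.mpr ⟨by positivity, ?_⟩
    nlinarith [norm_nonneg x.fn, norm_nonneg x.dot]
  have h3 : ‖x.fn‖ ≤ B * ‖embed x‖ := by
    rw [← toLp_rep]
    exact ContinuousLinearMap.le_opNorm _ _
  rw [dotL_apply]
  nlinarith [norm_nonneg x.dot, norm_nonneg (embed x), mul_nonneg (norm_nonneg
    (ContinuousMap.toLp 2 volume ℝ :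
      C(AddCircle T, EuclideanSpace ℝ (Fin N)) →L[ℝ] L2 T N)) (norm_nonneg x.dot)]

/-- Rellich's theorem: a sequence bounded in `E` has a uniformly convergent subsequence. -/
theorem exists_tendsto_embed {x : ℕ → E T N} {R S : ℝ} (hR : ∀ k, ‖(x k).dot‖ ≤ R)
    (hS : ∀ k, ‖embed (x k) (0 : ℝ)‖ ≤ S) :
    ∃ (u : C(AddCircle T, EuclideanSpace ℝ (Fin N))) (σ : ℕ → ℕ), StrictMono σ ∧
      Tendsto (fun k => embed (x (σ k))) atTop (𝓝 u) := by
  have hT : 0 < T := Fact.out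
  set e := ContinuousMap.isometryEquivBoundedOfCompact (AddCircle T) (EuclideanSpace ℝ (Fin N))
  set A := Set.range fun k => e (embed (x k))
  have hA : IsCompact (closure A) := by
    refine BoundedContinuousFunction.arzela_ascoli (Metric.closedBall 0 (S + √T * R))
      (isCompact_closedBall _ _) A ?_ ?_
    · rintro _ s ⟨k, rfl⟩
      rw [mem_closedBall_zero_iff]
      calc ‖embed (x k) s‖ = ‖embed (x k) (0 : ℝ) + (embed (x k) s - embed (x k) (0 : ℝ))‖ := by
            rw [add_sub_cancel]
        _ ≤ S + √T * R := by
            refine (norm_add_le _ _).trans (add_le_add (hS k) ((norm_embed_sub_le _ _).trans ?_))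
            gcongr
            exact hR k
    · intro s
      obtain ⟨a, rfl⟩ := QuotientAddGroup.mk_surjective s
      rw [Metric.equicontinuousAt_iff_right]
      intro ε hε
      rw [QuotientAddGroup.nhds_eq, eventually_map]
      -- The bound by `T` allows the Hölder estimate to be applied; the `+ 1` keeps the denominator
      -- positive when `R = 0`.
      have hδ : 0 < min T (ε ^ 2 / (R ^ 2 + 1)) := by positivity
      filter_upwards [Metric.ball_mem_nhds a hδ] with b hb
      rintro ⟨_, k, rfl⟩
      rw [Metric.mem_ball, Real.dist_eq, lt_min_iff] at hb
      have h1 := norm_embed_sub_sq_le (x k) hb.1.le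
      have h2 := hb.2
      rw [lt_div_iff₀ (by positivity)] at h2
      rw [dist_comm, dist_eq_norm]
      change ‖embed (x k) b - embed (x k) a‖ < ε
      refine lt_of_pow_lt_pow_left₀ 2 hε.le (h1.trans_lt (lt_of_le_of_lt ?_ h2))
      gcongr
      nlinarith [hR k, norm_nonneg (x k).dot]
  obtain ⟨w, -, σ, hσ, hw⟩ := hA.tendsto_subseq fun k => subset_closure (Set.mem_range_self k)
  refine ⟨e.symm w, σ, hσ, ?_⟩
  have := (e.symm.continuous.tendsto w).comp hw
  exact this.congr fun k => e.symm_apply_apply _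

end Sobolev

/-! ### The cosine as a `C¹` map on continuous functions -/

section Phase

variable {T : ℝ} [Fact (0 < T)]

/-- The real part of a complex-valued continuous function. -/
def reC : C(AddCircle T, ℂ) →L[ℝ] C(AddCircle T, ℝ) :=
  Complex.reCLM.compLeftContinuous ℝ (AddCircle T)

/-- Multiplication by `i` as a map from real-valued to complex-valued continuous functions. -/
def mulI : C(AddCircle T, ℝ) →L[ℝ] C(AddCircle T, ℂ) :=
  (Complex.I • Complex.ofRealCLM).compLeftContinuous ℝ (AddCircle T)

/-- `w ↦ cos (w + 2πnt/T)` on continuous functions on the circle. -/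
def cosPhase (n : ℤ) (w : C(AddCircle T, ℝ)) : C(AddCircle T, ℝ) :=
  reC (NormedSpace.exp (mulI w) * fourier n)

/-- The exponential of the Banach algebra `C(AddCircle T, ℂ)` is analytic, and the drift enters only
as multiplication by the fixed character `fourier n`. -/
theorem contDiff_cosPhase (n : ℤ) :
    ContDiff ℝ 1 (cosPhase n : C(AddCircle T, ℝ) → C(AddCircle T, ℝ)) := by
  have h : ContDiff ℝ 1 (NormedSpace.exp : C(AddCircle T, ℂ) → C(AddCircle T, ℂ)) :=
    contDiff_iff_contDiffAt.mpr fun x => (NormedSpace.exp_analytic (𝕂 := ℝ) x).contDiffAt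
  exact reC.contDiff.comp ((h.comp mulI.contDiff).mul contDiff_const)

theorem exp_continuousMap_apply (w : C(AddCircle T, ℂ)) (s : AddCircle T) :
    NormedSpace.exp w s = Complex.exp (w s) := by
  rw [Complex.exp_eq_exp_ℂ]
  exact NormedSpace.map_exp (ContinuousMap.evalAlgHom ℝ ℂ s) (continuous_eval_const s) w

theorem cosPhase_coe (n : ℤ) (w : C(AddCircle T, ℝ)) (t : ℝ) :
    cosPhase n w (t : AddCircle T) = Real.cos (w t + 2 * Real.pi * n * t / T) := by
  change (NormedSpace.exp (mulI w) (t : AddCircle T) * fourier n (t : AddCircle T)).re = _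
  rw [exp_continuousMap_apply, fourier_coe_apply, ← Complex.exp_add]
  change (Complex.exp (Complex.I * (w t : ℂ) + _)).re = _
  rw [show Complex.I * (w t : ℂ) + 2 * Real.pi * Complex.I * n * t / T
    = ((w t + 2 * Real.pi * n * t / T : ℝ) : ℂ) * Complex.I by push_cast; ring,
    Complex.exp_ofReal_mul_I_re]

theorem abs_cosPhase_le (n : ℤ) (w : C(AddCircle T, ℝ)) (s : AddCircle T) :
    |cosPhase n w s| ≤ 1 := by
  obtain ⟨t, rfl⟩ := QuotientAddGroup.mk_surjective s
  exact (cosPhase_coe n w t).symm ▸ Real.abs_cos_le_one _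

/-- The integral as a continuous linear functional on continuous functions. -/
def integralC : C(AddCircle T, ℝ) →L[ℝ] ℝ :=
  (L1.integralCLM (α := AddCircle T) (E := ℝ)).comp (ContinuousMap.toLp 1 volume ℝ)

theorem integralC_apply (w : C(AddCircle T, ℝ)) : integralC w = ∫ s, w s := by
  change L1.integralCLM (ContinuousMap.toLp 1 volume ℝ w) = _
  rw [← L1.integral_eq, L1.integral_eq_integral]
  exact integral_congr_ae (ContinuousMap.coeFn_toLp volume w)

end Phase

/-! ### The action as a quadratic functional -/

section Action

variable {T : ℝ} [Fact (0 < T)] {N : ℕ}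

/-- The bilinear form `(a, b) ↦ a_i b_j`. -/
def coordForm (i j : Fin N) :
    EuclideanSpace ℝ (Fin N) →L[ℝ] EuclideanSpace ℝ (Fin N) →L[ℝ] ℝ :=
  (ContinuousLinearMap.mul ℝ ℝ).bilinearComp (EuclideanSpace.proj i) (EuclideanSpace.proj j)

theorem coordForm_apply (i j : Fin N) (a b : EuclideanSpace ℝ (Fin N)) :
    coordForm i j a b = a i * b j := rfl

/-- The bilinear forms `(y, z) ↦ ∫ w y_i z_j` on `L²`, depending on the weight `w`. -/
def weightedForm (i j : Fin N) : C(AddCircle T, ℝ) →L[ℝ] L2 T N →L[ℝ] L2 T N →L[ℝ] ℝ :=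
  -- Multiplication by a bounded weight acts on `L²`, and the coordinate pairing follows. Building
  -- the form from bounded operators makes its continuous linear dependence on `w` automatic.
  (ContinuousLinearMap.compL ℝ (L2 T N) (L2 T N) (L2 T N →L[ℝ] ℝ)
      ((coordForm i j).lpPairing volume 2 2)).comp
    (((ContinuousLinearMap.lsmul ℝ ℝ).holderL volume ⊤ 2 2).comp (ContinuousMap.toLp ⊤ volume ℝ))

theorem integrable_weighted (i j : Fin N) (w : C(AddCircle T, ℝ)) (y z : L2 T N) :
    Integrable fun s => w s * y s i * z s j := by
  have h : Integrable fun s => y s i * z s j :=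
    MemLp.integrable_mul (p := 2) (q := 2)
      ((EuclideanSpace.proj i : EuclideanSpace ℝ (Fin N) →L[ℝ] ℝ).comp_memLp' (Lp.memLp y))
      ((EuclideanSpace.proj j : EuclideanSpace ℝ (Fin N) →L[ℝ] ℝ).comp_memLp' (Lp.memLp z))
  simp only [mul_assoc]
  exact h.bdd_mul w.continuous.aestronglyMeasurable (Eventually.of_forall w.norm_coe_le_norm)

theorem weightedForm_apply (i j : Fin N) (w : C(AddCircle T, ℝ)) (y z : L2 T N) :
    weightedForm i j w y z = ∫ s, w s * y s i * z s j := by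
  change (coordForm i j).lpPairing volume 2 2
    ((ContinuousLinearMap.lsmul ℝ ℝ).holder 2 (ContinuousMap.toLp ⊤ volume ℝ w) y) z = _
  rw [ContinuousLinearMap.lpPairing_eq_integral]
  refine integral_congr_ae ?_
  filter_upwards [ContinuousLinearMap.coeFn_holder (r := 2) (ContinuousLinearMap.lsmul ℝ ℝ)
    (ContinuousMap.toLp ⊤ volume ℝ w : Lp ℝ ⊤ (volume : Measure (AddCircle T))) y,
    ContinuousMap.coeFn_toLp volume (p := ⊤) (𝕜 := ℝ) w] with s h1 h2
  rw [h1, h2, coordForm_apply]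
  rfl

/-- The coordinates of a vector-valued continuous function. -/
def coordC (i : Fin N) : C(AddCircle T, EuclideanSpace ℝ (Fin N)) →L[ℝ] C(AddCircle T, ℝ) :=
  (EuclideanSpace.proj i : EuclideanSpace ℝ (Fin N) →L[ℝ] ℝ).compLeftContinuous ℝ (AddCircle T)

theorem coordC_apply {T : ℝ} {N : ℕ} (i : Fin N) (u : C(AddCircle T, EuclideanSpace ℝ (Fin N))) (s : AddCircle T) :
    coordC i u s = u s i := rfl

/-- The quadratic form `p ↦ ∫ A(q)p·p` on `L²`, `q(t) = u(t) + 2πvt/T`. -/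
def kineticForm (m ℓ : Fin N → ℝ) (v : Fin N → ℤ) (u : C(AddCircle T, EuclideanSpace ℝ (Fin N))) :
    L2 T N →L[ℝ] L2 T N →L[ℝ] ℝ :=
  ∑ i, ∑ j, massCoeff m ℓ i j • weightedForm i j (cosPhase (v i - v j) (coordC i u - coordC j u))

/-- The part of the action that depends on the position only. -/
def positionAction (m ℓ : Fin N → ℝ) (g : ℝ) (v : Fin N → ℤ) (f : L2 T N)
    (u : C(AddCircle T, EuclideanSpace ℝ (Fin N))) : ℝ :=
  g * (∑ j, beta m ℓ j * integralC (cosPhase (v j) (coordC j u)))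
    + inner ℝ f (ContinuousMap.toLp 2 volume ℝ u)
    + ∫ t in (0 : ℝ)..T, inner ℝ (f (t : AddCircle T)) ((t / T) • twoPi N v)

/-- The constant mean velocity `2πv/T`. -/
def meanVelocity (T : ℝ) [Fact (0 < T)] {N : ℕ} (v : Fin N → ℤ) : L2 T N :=
  Lp.const 2 volume ((1 / T) • twoPi N v)

set_option maxSynthPendingDepth 3 in
set_option synthInstance.maxHeartbeats 200000 in
theorem contDiff_kineticForm (m ℓ : Fin N → ℝ) (v : Fin N → ℤ) :
    ContDiff ℝ 1 (kineticForm (T := T) m ℓ v) := by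
  refine ContDiff.sum fun i _ => ContDiff.sum fun j _ => ContDiff.const_smul _ ?_
  exact (weightedForm i j :
      C(AddCircle T, ℝ) →L[ℝ] L2 T N →L[ℝ] L2 T N →L[ℝ] ℝ).contDiff.comp
    ((contDiff_cosPhase (v i - v j)).comp (coordC i - coordC j :
      C(AddCircle T, EuclideanSpace ℝ (Fin N)) →L[ℝ] C(AddCircle T, ℝ)).contDiff)

theorem contDiff_positionAction (m ℓ : Fin N → ℝ) (g : ℝ) (v : Fin N → ℤ) (f : L2 T N) :
    ContDiff ℝ 1 (positionAction m ℓ g v f) := by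
  refine ((contDiff_const.mul (ContDiff.sum fun j _ => contDiff_const.mul ?_)).add ?_).add
    contDiff_const
  · exact integralC.contDiff.comp ((contDiff_cosPhase (v j)).comp
      (coordC j : C(AddCircle T, EuclideanSpace ℝ (Fin N)) →L[ℝ] C(AddCircle T, ℝ)).contDiff)
  · exact ((innerSL ℝ f).comp (ContinuousMap.toLp 2 volume ℝ)).contDiff

theorem kineticForm_apply (m ℓ : Fin N → ℝ) (v : Fin N → ℤ)
    (u : C(AddCircle T, EuclideanSpace ℝ (Fin N))) (p p' : L2 T N) :
    kineticForm m ℓ v u p p' = ∑ i, ∑ j, massCoeff m ℓ i j *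
      ∫ s, cosPhase (v i - v j) (coordC i u - coordC j u) s * p s i * p' s j := by
  simp only [kineticForm, sum_apply, smul_apply, weightedForm_apply, smul_eq_mul]

theorem twoPi_apply (v : Fin N → ℤ) (i : Fin N) : twoPi N v i = 2 * Real.pi * v i := rfl

theorem cosPhase_sub_coe (v : Fin N → ℤ) (u : C(AddCircle T, EuclideanSpace ℝ (Fin N)))
    (i j : Fin N) (t : ℝ) : cosPhase (v i - v j) (coordC i u - coordC j u) (t : AddCircle T)
      = Real.cos ((u t + (t / T) • twoPi N v) i - (u t + (t / T) • twoPi N v) j) := by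
  rw [cosPhase_coe]
  congr 1
  simp only [ContinuousMap.sub_apply, coordC_apply, PiLp.add_apply, PiLp.smul_apply, twoPi_apply,
    smul_eq_mul]
  push_cast
  ring

theorem cosPhase_coord_coe (v : Fin N → ℤ) (u : C(AddCircle T, EuclideanSpace ℝ (Fin N)))
    (j : Fin N) (t : ℝ) : cosPhase (v j) (coordC j u) (t : AddCircle T)
      = Real.cos ((u t + (t / T) • twoPi N v) j) := by
  rw [cosPhase_coe]
  congr 1
  simp only [coordC_apply, PiLp.add_apply, PiLp.smul_apply, twoPi_apply, smul_eq_mul]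
  ring

theorem kineticForm_comm (m ℓ : Fin N → ℝ) (v : Fin N → ℤ)
    (u : C(AddCircle T, EuclideanSpace ℝ (Fin N))) (p p' : L2 T N) :
    kineticForm m ℓ v u p p' = kineticForm m ℓ v u p' p := by
  rw [kineticForm_apply, kineticForm_apply, Finset.sum_comm]
  refine Finset.sum_congr rfl fun i _ => Finset.sum_congr rfl fun j _ => ?_
  rw [massCoeff_comm]
  congr 1
  refine integral_congr_ae (Eventually.of_forall fun s => ?_)
  obtain ⟨t, rfl⟩ := QuotientAddGroup.mk_surjective s
  have h := cosPhase_sub_coe v u j i t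
  rw [← Real.cos_neg, neg_sub, ← cosPhase_sub_coe v u i j t] at h
  dsimp only
  refine Eq.trans (congrArg (fun z => z * _ * _) h) ?_
  exact mul_right_comm _ _ _

theorem integrable_kinetic (m ℓ : Fin N → ℝ) (v : Fin N → ℤ)
    (u : C(AddCircle T, EuclideanSpace ℝ (Fin N))) (p : L2 T N) :
    Integrable fun s => ∑ i, ∑ j, massCoeff m ℓ i j *
      (cosPhase (v i - v j) (coordC i u - coordC j u) s * p s i * p s j) :=
  integrable_finsetSum _ fun i _ => integrable_finsetSum _ fun j _ =>
    (integrable_weighted i j _ p p).const_mul _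

theorem kineticForm_eq_integral (m ℓ : Fin N → ℝ) (v : Fin N → ℤ)
    (u : C(AddCircle T, EuclideanSpace ℝ (Fin N))) (p : L2 T N) :
    kineticForm m ℓ v u p p = ∫ s, ∑ i, ∑ j, massCoeff m ℓ i j *
      (cosPhase (v i - v j) (coordC i u - coordC j u) s * p s i * p s j) := by
  rw [kineticForm_apply, integral_finsetSum _ fun i _ => integrable_finsetSum _ fun j _ =>
    (integrable_weighted i j _ p p).const_mul _]
  refine Finset.sum_congr rfl fun i _ => ?_
  rw [integral_finsetSum _ fun j _ => (integrable_weighted i j _ p p).const_mul _]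
  exact Finset.sum_congr rfl fun j _ => (integral_const_mul _ _).symm

/-- The pointwise coercivity has a constant independent of the configuration, so it integrates to
the same constant for every `u`. -/
theorem le_kineticForm {m ℓ : Fin N → ℝ} {c : ℝ}
    (hc : ∀ q p : EuclideanSpace ℝ (Fin N), c * ‖p‖ ^ 2 ≤ kinetic m ℓ q p) (v : Fin N → ℤ)
    (u : C(AddCircle T, EuclideanSpace ℝ (Fin N))) (p : L2 T N) :
    c * ‖p‖ ^ 2 ≤ kineticForm m ℓ v u p p := by
  rw [kineticForm_eq_integral, norm_sq_eq_integral, ← integral_const_mul]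
  refine integral_mono (((Lp.memLp p).integrable_norm_pow (by norm_num)).const_mul c)
    (integrable_kinetic m ℓ v u p) fun s => ?_
  obtain ⟨t, rfl⟩ := QuotientAddGroup.mk_surjective s
  refine (hc (u (t : AddCircle T) + (t / T) • twoPi N v) (p (t : AddCircle T))).trans_eq ?_
  rw [kinetic_eq_sum]
  exact Finset.sum_congr rfl fun i _ => Finset.sum_congr rfl fun j _ => by
    rw [← cosPhase_sub_coe]

/-- The periodic part of the integrand of the action, as a function on the circle. -/
def circleIntegrand (m ℓ : Fin N → ℝ) (g : ℝ) (v : Fin N → ℤ) (f : L2 T N) (x : E T N)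
    (s : AddCircle T) : ℝ :=
  1 / 2 * (∑ i, ∑ j, massCoeff m ℓ i j *
    (cosPhase (v i - v j) (coordC i (embed x) - coordC j (embed x)) s
      * (dotL x + meanVelocity T v) s i * (dotL x + meanVelocity T v) s j))
  + g * (∑ j, beta m ℓ j * cosPhase (v j) (coordC j (embed x)) s)
  + inner ℝ (f s) (ContinuousMap.toLp 2 volume ℝ (embed x) s)

/-- The drift inside the cosines is absorbed into periodic functions. The only non-periodic
remainder is the pairing of `f` with the drift, which does not depend on `x`. -/
theorem integrand_ae_eq (m ℓ : Fin N → ℝ) (g : ℝ) (v : Fin N → ℤ) (f : L2 T N) (x : E T N) :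
    ∀ᵐ t : ℝ ∂(volume.restrict (Set.Ioc (0 : ℝ) T)), integrand m ℓ g v f x t
      = circleIntegrand m ℓ g v f x (t : AddCircle T)
        + inner ℝ (f (t : AddCircle T)) ((t / T) • twoPi N v) := by
  filter_upwards [ae_coe (coeFn_fn x), ae_coe (ContinuousMap.coeFn_toLp volume (p := 2) (𝕜 := ℝ)
    (embed x)), ae_coe (Lp.coeFn_add (dotL x) (meanVelocity T v)),
    ae_coe (Lp.coeFn_const (p := 2) (μ := (volume : Measure (AddCircle T)))
      ((1 / T) • twoPi N v))] with t h1 h2 h3 h4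
  have hp : position v x t = embed x (t : AddCircle T) + (t / T) • twoPi N v := by
    rw [position, h1, embed_apply]
  have hv : velocity v x t = (dotL x + meanVelocity T v) (t : AddCircle T) := by
    rw [h3, Pi.add_apply, velocity, dotL_apply]
    exact congrArg (x.dot (t : AddCircle T) + ·) h4.symm
  simp only [circleIntegrand, integrand, lagrangian, potential, hp, hv, kinetic_eq_sum, h2, inner_add_right,
    ← cosPhase_sub_coe, ← cosPhase_coord_coe]
  exact (add_assoc _ _ _).symm

theorem integrable_potential (m ℓ : Fin N → ℝ) (v : Fin N → ℤ)
    (u : C(AddCircle T, EuclideanSpace ℝ (Fin N))) (j : Fin N) :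
    Integrable fun s => beta m ℓ j * cosPhase (v j) (coordC j u) s :=
  Integrable.const_mul ((cosPhase (v j) (coordC j u)).continuous.integrable_of_hasCompactSupport
    (HasCompactSupport.of_compactSpace _)) _

theorem integrable_circleIntegrand (m ℓ : Fin N → ℝ) (g : ℝ) (v : Fin N → ℤ) (f : L2 T N)
    (x : E T N) : Integrable (circleIntegrand m ℓ g v f x) :=
  (((integrable_kinetic m ℓ v _ _).const_mul _).add (Integrable.const_mul
    (integrable_finsetSum _ fun j _ => integrable_potential m ℓ v _ j) g)).add
    (L2.integrable_inner f _)

theorem integral_circleIntegrand (m ℓ : Fin N → ℝ) (g : ℝ) (v : Fin N → ℤ) (f : L2 T N)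
    (x : E T N) : ∫ s, circleIntegrand m ℓ g v f x s
      = 1 / 2 * kineticForm m ℓ v (embed x) (dotL x + meanVelocity T v) (dotL x + meanVelocity T v)
        + (g * (∑ j, beta m ℓ j * integralC (cosPhase (v j) (coordC j (embed x))))
        + inner ℝ f (ContinuousMap.toLp 2 volume ℝ (embed x))) := by
  have h1 := (integrable_kinetic m ℓ v (embed x) (dotL x + meanVelocity T v)).const_mul (1 / 2)
  have h2 := Integrable.const_mul (integrable_finsetSum Finset.univ fun j _ =>
    integrable_potential m ℓ v (embed x) j) g
  have h3 := L2.integrable_inner (𝕜 := ℝ) f (ContinuousMap.toLp 2 volume ℝ (embed x))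
  rw [kineticForm_eq_integral, L2.inner_def, ← add_assoc]
  refine (integral_add (h1.add h2) h3).trans (congrArg (· + _) ?_)
  refine (integral_add h1 h2).trans ?_
  rw [integral_const_mul, integral_const_mul, integral_finsetSum _ fun j _ =>
    integrable_potential m ℓ v _ j]
  simp only [integralC_apply, integral_const_mul]

theorem intervalIntegrable_inner_drift (v : Fin N → ℤ) (f : L2 T N) :
    IntervalIntegrable (fun t : ℝ => inner ℝ (f (t : AddCircle T)) ((t / T) • twoPi N v))
      volume 0 T := by
  have h : IntervalIntegrable (fun t : ℝ => inner ℝ (f (t : AddCircle T)) (twoPi N v))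
      volume 0 T := by
    have := intervalIntegrable_coe f
    exact ⟨this.1.inner_const _, this.2.inner_const _⟩
  simp only [inner_smul_right]
  exact h.continuousOn_mul (by fun_prop)

theorem intervalIntegrable_integrand (m ℓ : Fin N → ℝ) (g : ℝ) (v : Fin N → ℤ) (f : L2 T N)
    (x : E T N) : IntervalIntegrable (integrand m ℓ g v f x) volume 0 T := by
  have hT : 0 < T := Fact.out
  refine ((intervalIntegrable_coe_of_integrable (integrable_circleIntegrand m ℓ g v f x)
    0 T).add (intervalIntegrable_inner_drift v f)).congr_ae ?_
  rw [Set.uIoc_of_le hT.le]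
  filter_upwards [integrand_ae_eq m ℓ g v f x] with t ht using ht.symm

theorem action_eq_quadAction (m ℓ : Fin N → ℝ) (g : ℝ) (v : Fin N → ℤ) (f : L2 T N) :
    action m ℓ g v f = quadAction embed dotL (meanVelocity T v) (kineticForm m ℓ v)
      (positionAction m ℓ g v f) := by
  funext x
  rw [action, intervalIntegral_congr_coe (integrand_ae_eq m ℓ g v f x),
    intervalIntegral.integral_add (intervalIntegrable_coe_of_integrable
      (integrable_circleIntegrand m ℓ g v f x) 0 T) (intervalIntegrable_inner_drift v f),
    intervalIntegral_coe, integral_circleIntegrand, quadAction, positionAction]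
  ring

end Action

/-! ### Coercivity, the lower bound and the Palais–Smale condition -/

section Coercivity

variable {T : ℝ} [Fact (0 < T)] {N : ℕ}

theorem inner_const_eq_zero {f : L2 T N} (hf : ∫ t, f t = 0) (c : EuclideanSpace ℝ (Fin N)) :
    inner ℝ f (ContinuousMap.toLp 2 volume ℝ (ContinuousMap.const (AddCircle T) c)) = 0 := by
  rw [L2.inner_def]
  have h := integral_inner (𝕜 := ℝ) (integrable_L2 f) c
  rw [hf, inner_zero_right] at h
  rw [← h]
  refine integral_congr_ae ?_
  filter_upwards [ContinuousMap.coeFn_toLp volume (p := 2) (𝕜 := ℝ)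
    (ContinuousMap.const (AddCircle T) c)] with s hs
  rw [hs, ContinuousMap.const_apply, real_inner_comm]

/-- As `f` has mean zero, the constant `embed x 0` may be subtracted from `embed x`; the remainder
is at most `√T * ‖x.dot‖` uniformly. -/
theorem abs_inner_embed_le {f : L2 T N} (hf : ∫ t, f t = 0) :
    ∃ M : ℝ, ∀ x : E T N,
      |inner ℝ f (ContinuousMap.toLp 2 volume ℝ (embed x))| ≤ M * ‖dotL x‖ := by
  set B := ‖(ContinuousMap.toLp 2 volume ℝ :
    C(AddCircle T, EuclideanSpace ℝ (Fin N)) →L[ℝ] L2 T N)‖ with hB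
  refine ⟨‖f‖ * (B * √T), fun x => ?_⟩
  have h1 : inner ℝ f (ContinuousMap.toLp 2 volume ℝ (embed x))
      = inner ℝ f (ContinuousMap.toLp 2 volume ℝ
        (embed x - ContinuousMap.const (AddCircle T) (embed x (0 : ℝ)))) := by
    rw [map_sub, inner_sub_right, inner_const_eq_zero hf, sub_zero]
  have h2 : ‖embed x - ContinuousMap.const (AddCircle T) (embed x (0 : ℝ))‖ ≤ √T * ‖x.dot‖ :=
    (ContinuousMap.norm_le _ (by positivity)).mpr (norm_embed_sub_le x)
  rw [h1]
  refine (abs_real_inner_le_norm _ _).trans ?_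
  rw [mul_assoc, mul_assoc]
  gcongr
  refine (ContinuousLinearMap.le_opNorm _ _).trans ?_
  rw [← hB]
  gcongr
  exact h2

theorem abs_integralC_cosPhase_le (n : ℤ) (w : C(AddCircle T, ℝ)) :
    |integralC (cosPhase n w)| ≤ T := by
  have hT : 0 < T := Fact.out
  rw [integralC_apply, ← intervalIntegral_coe]
  have h := intervalIntegral.norm_integral_le_of_norm_le_const (a := 0) (b := T) (C := 1)
    (f := fun t : ℝ => cosPhase n w (t : AddCircle T)) fun t _ => abs_cosPhase_le n w t
  rwa [one_mul, sub_zero, abs_of_pos hT] at h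

/-- The action grows quadratically in the velocity. -/
theorem exists_le_action {m ℓ : Fin N → ℝ} (hm : ∀ i, 0 < m i) (hℓ : ∀ i, 0 < ℓ i) (g : ℝ)
    (v : Fin N → ℤ) {f : L2 T N} (hf : ∫ t, f t = 0) :
    ∃ a b c : ℝ, 0 < a ∧ ∀ x : E T N,
      a * ‖dotL x + meanVelocity T v‖ ^ 2 - b * ‖dotL x + meanVelocity T v‖ - c
        ≤ action m ℓ g v f x := by
  obtain ⟨κ, hκ, hκm⟩ := exists_le_kinetic hm hℓ
  obtain ⟨M, hM⟩ := abs_inner_embed_le hf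
  -- `κ` is the coercivity constant and `M` bounds the forcing term by the velocity. The drift
  -- integral belongs to the action, hence its minus sign inside the subtracted constant.
  refine ⟨1 / 2 * κ, |M|, |M| * ‖meanVelocity T v‖ + |g| * (∑ j, |beta m ℓ j| * T)
    - ∫ t in (0 : ℝ)..T, inner ℝ (f (t : AddCircle T)) ((t / T) • twoPi N v), by positivity,
    fun x => ?_⟩
  rw [action_eq_quadAction, quadAction, positionAction]
  have h1 := le_kineticForm hκm v (embed x) (dotL x + meanVelocity T v)
  have h2 : |inner ℝ f (ContinuousMap.toLp 2 volume ℝ (embed x))|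
      ≤ |M| * (‖dotL x + meanVelocity T v‖ + ‖meanVelocity T v‖) := by
    refine (hM x).trans (mul_le_mul (le_abs_self M) ?_ (norm_nonneg _) (abs_nonneg M))
    simpa using norm_sub_le (dotL x + meanVelocity T v) (meanVelocity T v)
  have h3 : |g * ∑ j, beta m ℓ j * integralC (cosPhase (v j) (coordC j (embed x)))|
      ≤ |g| * ∑ j, |beta m ℓ j| * T := by
    rw [abs_mul]
    gcongr
    refine (Finset.abs_sum_le_sum_abs _ _).trans (Finset.sum_le_sum fun j _ => ?_)
    rw [abs_mul]
    gcongr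
    exact abs_integralC_cosPhase_le _ _
  rw [abs_le] at h2 h3
  linarith [h2.1, h3.1]

theorem bddBelow_action {m ℓ : Fin N → ℝ} (hm : ∀ i, 0 < m i) (hℓ : ∀ i, 0 < ℓ i) (g : ℝ)
    (v : Fin N → ℤ) {f : L2 T N} (hf : ∫ t, f t = 0) :
    ∃ C : ℝ, ∀ x : E T N, C ≤ action m ℓ g v f x := by
  obtain ⟨a, b, c, ha, h⟩ := exists_le_action hm hℓ g v hf
  -- The minimum of `a * r ^ 2 - b * r - c` over real `r`, by completing the square.
  refine ⟨-(b ^ 2 / (4 * a)) - c, fun x => le_trans ?_ (h x)⟩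
  set r := ‖dotL x + meanVelocity T v‖
  have : a * r ^ 2 - b * r + b ^ 2 / (4 * a) = a * (r - b / (2 * a)) ^ 2 := by
    field_simp
    ring
  nlinarith [mul_nonneg ha.le (sq_nonneg (r - b / (2 * a)))]

theorem exists_norm_dot_le {m ℓ : Fin N → ℝ} (hm : ∀ i, 0 < m i) (hℓ : ∀ i, 0 < ℓ i) (g : ℝ)
    (v : Fin N → ℤ) {f : L2 T N} (hf : ∫ t, f t = 0) (C : ℝ) :
    ∃ R : ℝ, ∀ x : E T N, action m ℓ g v f x ≤ C → ‖x.dot‖ ≤ R := by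
  obtain ⟨a, b, c, ha, h⟩ := exists_le_action hm hℓ g v hf
  -- If `r` exceeded the first two terms, then `r > 1` and `a * r ^ 2 > (|b| + |C + c|) * r ≥ b * r
  -- + C + c`, against the upper bound `C`. The last term passes from the total velocity to `x.dot`.
  refine ⟨1 + (|b| + |C + c|) / a + ‖meanVelocity T v‖, fun x hx => ?_⟩
  have h1 := (h x).trans hx
  have h2 : ‖x.dot‖ ≤ ‖dotL x + meanVelocity T v‖ + ‖meanVelocity T v‖ := by
    simpa [dotL_apply] using norm_sub_le (dotL x + meanVelocity T v) (meanVelocity T v)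
  refine h2.trans (add_le_add_left ?_ _)
  set r := ‖dotL x + meanVelocity T v‖
  have hq : 0 ≤ (|b| + |C + c|) / a := by positivity
  by_contra! hr
  have h3 : (|b| + |C + c|) < a * r := by
    have : (|b| + |C + c|) / a < r := by linarith
    rwa [div_lt_iff₀ ha, mul_comm] at this
  have h4 : 1 < r := by linarith
  nlinarith [le_abs_self b, le_abs_self (C + c), abs_nonneg b, abs_nonneg (C + c),
    mul_le_mul_of_nonneg_right (le_abs_self b) (zero_le_one.trans h4.le)]

theorem embed_constFn (c : EuclideanSpace ℝ (Fin N)) :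
    embed (constFn T N c) = ContinuousMap.const (AddCircle T) c := by
  refine (eq_rep_of_toLp_eq (Lp.ext ?_)).symm
  exact (ContinuousMap.coeFn_toLp volume _).trans (Lp.coeFn_const (p := 2)
    (μ := (volume : Measure (AddCircle T))) c).symm

/-- Every class in `E / 2πℤ^N` has a representative with a bounded value at the origin. -/
theorem exists_rep_mem_box (ξ : QuotE T N) :
    ∃ x : E T N, (x : QuotE T N) = ξ ∧ ‖embed x (0 : ℝ)‖ ≤ √(N * (2 * Real.pi) ^ 2) := by
  obtain ⟨y, rfl⟩ := QuotientAddGroup.mk_surjective ξ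
  -- Translating by this `k` replaces each coordinate at the origin by `2π` times a fractional part,
  -- hence by a number in `[0, 2π)`.
  set k : Fin N → ℤ := fun i => -⌊embed y (0 : ℝ) i / (2 * Real.pi)⌋ with hk
  refine ⟨y + constFn T N (twoPi N k), ?_, ?_⟩
  · exact QuotientAddGroup.mk_add_of_mem y ⟨k, rfl⟩
  · rw [map_add, embed_constFn, EuclideanSpace.norm_eq]
    refine Real.sqrt_le_sqrt ?_
    have h : ∀ i, ‖(embed y + ContinuousMap.const (AddCircle T) (twoPi N k)) (0 : ℝ) i‖ ^ 2
        ≤ (2 * Real.pi) ^ 2 := by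
      intro i
      have h1 : (embed y + ContinuousMap.const (AddCircle T) (twoPi N k)) (0 : ℝ) i
          = 2 * Real.pi * Int.fract (embed y (0 : ℝ) i / (2 * Real.pi)) := by
        change embed y (0 : ℝ) i + 2 * Real.pi * (k i : ℝ) = _
        rw [Int.fract, hk]
        have := Real.pi_pos
        push_cast
        field_simp
        ring
      rw [h1, Real.norm_eq_abs, sq_abs]
      have h2 := Int.fract_nonneg (embed y (0 : ℝ) i / (2 * Real.pi))
      have h3 := (Int.fract_lt_one (embed y (0 : ℝ) i / (2 * Real.pi))).le
      rw [mul_pow]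
      exact mul_le_of_le_one_right (by positivity) (pow_le_one₀ h2 h3)
    calc _ ≤ ∑ _i : Fin N, (2 * Real.pi) ^ 2 := Finset.sum_le_sum fun i _ => h i
      _ = _ := by simp

/-- The derivative on the quotient can be computed at any representative, so the Palais–Smale
hypothesis becomes a statement about the chosen sequence in `E`. -/
theorem derivAt_actionQuot_coe (m ℓ : Fin N → ℝ) (g : ℝ) (v : Fin N → ℤ) {f : L2 T N}
    (hf : ∫ t, f t = 0) (x : E T N) :
    derivAt (actionQuot m ℓ g v f hf) (x : QuotE T N) = fderiv ℝ (action m ℓ g v f) x := by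
  change fderiv ℝ (fun y : E T N => action m ℓ g v f (x + y)) 0 = _
  rw [fderiv_comp_add_left, add_zero]

theorem palaisSmale_actionQuot {m ℓ : Fin N → ℝ} (hm : ∀ i, 0 < m i) (hℓ : ∀ i, 0 < ℓ i) (g : ℝ)
    (v : Fin N → ℤ) {f : L2 T N} (hf : ∫ t, f t = 0) :
    PalaisSmale (actionQuot m ℓ g v f hf) := by
  rintro ξ ⟨C, hC⟩ hξ
  -- Neither the action nor its derivative controls the mean of `x`; choosing representatives in a
  -- bounded box supplies the missing bound.
  choose x hx hx0 using fun k => exists_rep_mem_box (ξ k)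
  obtain rfl : (fun k => (x k : QuotE T N)) = ξ := funext hx
  obtain ⟨R, hR⟩ := exists_norm_dot_le hm hℓ g v hf C
  have hdot : ∀ k, ‖(x k).dot‖ ≤ R := fun k => hR (x k) (hC k)
  obtain ⟨u, σ, hσ, hu⟩ := exists_tendsto_embed hdot hx0
  obtain ⟨c, hc, hcm⟩ := exists_le_kinetic hm hℓ
  obtain ⟨A, hA⟩ := norm_le_embed_add_dot (T := T) (N := N)
  simp only [derivAt_actionQuot_coe, action_eq_quadAction] at hξ
  have hcauchy : CauchySeq fun k => x (σ k) :=
    cauchySeq_of_tendsto_fderiv_quadAction (contDiff_kineticForm m ℓ v)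
      (contDiff_positionAction m ℓ g v f) (kineticForm_comm m ℓ v) hc (le_kineticForm hcm v) hA hu
      (fun k => hdot (σ k)) (hξ.comp hσ.tendsto_atTop)
  obtain ⟨z, hz⟩ := cauchySeq_tendsto_of_complete hcauchy
  exact ⟨z, σ, hσ, (continuous_quotient_mk'.tendsto z).comp hz⟩

end Coercivity

end Pendulum

end

theorem proposition2p2 (N : ℕ) (m ℓ : Fin N → ℝ) (hm : ∀ i, 0 < m i) (hℓ : ∀ i, 0 < ℓ i)
    (g : ℝ) (T : ℝ) [Fact (0 < T)] (v : Fin N → ℤ)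
    (f : Pendulum.L2 T N) (hf : ∫ t, f t = 0) :
    (∀ x : Pendulum.E T N, IntervalIntegrable (Pendulum.integrand m ℓ g v f x) volume 0 T) ∧
    Pendulum.IsC1 (Pendulum.actionQuot m ℓ g v f hf) ∧
    BddBelow (Set.range (Pendulum.actionQuot m ℓ g v f hf)) ∧
    Pendulum.PalaisSmale (Pendulum.actionQuot m ℓ g v f hf) := by
  refine ⟨Pendulum.intervalIntegrable_integrand m ℓ g v f, ?_, ?_,
    Pendulum.palaisSmale_actionQuot hm hℓ g v hf⟩
  · change ContDiff ℝ 1 (Pendulum.action m ℓ g v f)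
    rw [Pendulum.action_eq_quadAction]
    exact Pendulum.contDiff_quadAction (Pendulum.contDiff_kineticForm m ℓ v)
      (Pendulum.contDiff_positionAction m ℓ g v f)
  · obtain ⟨C, hC⟩ := Pendulum.bddBelow_action hm hℓ g v hf
    refine ⟨C, ?_⟩
    rintro _ ⟨ξ, rfl⟩
    obtain ⟨x, rfl⟩ := QuotientAddGroup.mk_surjective ξ
    exact hC x
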